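/- Throughout, $N\in\mathbb N=\{1,2,\dots\}$, $[N]=\{1,\dots,N\}$, and $\otimes$ is the minimal tensor product of $C^*$-algebras. **Definitions.** Let $\mathcal C_N$ be the category whose objects are pairs $(D,M)$ of a $C^*$-algebra $D$ and an $N\times N$-matrix $M$ over $D$ whose entries generate $D$ as a $C^*$-algebra, and whose arrows $(D_1,M_1)\to(D_2,M_2)$ are the $*$-homomorphisms $D_1\to D_2$ sending each entry of $M_1$ to the corresponding entry of $M_2$. For matrices $x\in M_N(A)$, $y\in M_N(B)$ over $C^*$-algebras let $x\,⦶\,y\in M_N(A\otimes B)$ be the matrix with entries $\sum_{k=1}^N x_{ik}\otimes y_{kj}$. A *compact matrix quantum group* of size $N$ is an object $(A,u)$ of $\mathcal C_N$ such that $A$ is unital, $u$ is unitary, $u^{(*)}=(u_{ij}^*)_{i,j}$ is invertible, and there is a unital $*$-homomorphism $\Delta:A\to A\otimes A$ with $\Delta(u_{ij})=\sum_k u_{ik}\otimes u_{kj}$ for all $i,j$. A *two-coloured partition* $p\in\mathcal P(k,l)$, $k,l\ge 0$, is a partition into blocks of a set of $k$ upper and $l$ lower points, together with colours $\omega_1,\dots,\omega_k$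 of the upper and $\omega'_1,\dots,\omega'_l$ of the lower points, each colour being $\circ$ or $\bullet$. For $t\in[N]^k$, $t'\in[N]^l$ let $\delta_p(t,t')=1$ if the labelling of the upper points by $t$ and of the lower points by $t'$ is constant on each block, and $\delta_p(t,t')=0$ otherwise. For an element $a$ of a $*$-algebra put $a^\circ=a$, $a^\bullet=a^*$. For an $N\times N$-matrix $u$ over a unital $C^*$-algebra, the relations $\mathcal R_p(u)$ are $$\sum_{t\in[N]^k}\delta_p(t,\gamma')\,u_{t_1\gamma_1}^{\omega_1}\cdots u_{t_k\gamma_k}^{\omega_k}=\sum_{t'\in[N]^l}\delta_p(\gamma,t')\,u_{\gamma'_1t'_1}^{\omega'_1}\cdots u_{\gamma'_lt'_l}^{\omega'_l}\qquad(\gamma\in[N]^k,\ \gamma'\in[N]^l),$$ an empty product being $1$. Let $\Pi$ be a set of two-coloured partitions that contains the four one-block partitions in $\mathcal P(0,2)$ and $\mathcal P(2,0)$ whose two points are coloured $(\circ,\bullet)$ or $(\bullet,\circ)$. The easy quantum group $G_N(\Pi)=(C(G_N(\Pi)),u)$ is the object of $\mathcal C_N$ given by the universal unital $C^*$-algebra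 $C(G_N(\Pi))$ generated by elements $u_{ij}$ $(1\le i,j\le N)$ subject to the relations $\mathcal R_p(u)$ for all $p\in\Pi$. **Proposition.** Let $N$ and $\Pi$ be as above, and suppose that there are an object $(B_1,M_1)$ of $\mathcal C_N$ and arrows $$\big(C(G_N(\Pi)),u\big)\xrightarrow{\ \varphi_1\ }(B_1,M_1)\xrightarrow{\ \nu\ }(\mathbb C,1_{M_N(\mathbb C)})$$ in $\mathcal C_N$. For $n\ge1$ put $M_{n+1}:=M_n\,⦶\,M_1$, a matrix over $B_1^{\otimes(n+1)}=B_1^{\otimes n}\otimes B_1$, and let $B_n\subseteq B_1^{\otimes n}$ be the $C^*$-subalgebra generated by the entries of $M_n$. Then: 1. For every $n\ge 1$ the $*$-homomorphism $\mathrm{id}_{B_1}^{\otimes n}\otimes\nu:B_1^{\otimes(n+1)}\to B_1^{\otimes n}$, $a\otimes b\mapsto\nu(b)a$, exists and restricts to an arrow $\pi_{n+1,n}:(B_{n+1},M_{n+1})\to(B_n,M_n)$, so that $$(B_1,M_1)\xleftarrow{\ \pi_{2,1}\ }(B_2,M_2)\xleftarrow{\ \pi_{3,2}\ }(B_3,M_3)\xleftarrow{\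 \ \ }\cdots$$ is an inverse system in $\mathcal C_N$. 2. Every $(B_n,M_n)$ is a model of $C(G_N(\Pi))$: there is an arrow $(C(G_N(\Pi)),u)\to(B_n,M_n)$. 3. The limit $(B_\infty,M_\infty)=\lim_{\infty\leftarrow n}(B_n,M_n)$ of this inverse system exists in $\mathcal C_N$. It is a compact matrix quantum group $G$, and $G\subseteq G_N(\Pi)$, that is, there is an arrow $(C(G_N(\Pi)),u)\to(B_\infty,M_\infty)$. -/

import Mathlib

open CategoryTheory
open scoped TensorProduct ENNReal

universe u v

namespace CQG

noncomputable section

/-! ### C*-subalgebras generated by a set -/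

/-- `C*(s) ⊆ A`: the closed `*`-subalgebra of `A` generated by the set `s`. -/
abbrev cstarGen {A : Type u} [NonUnitalCStarAlgebra A] (s : Set A) : NonUnitalStarSubalgebra ℂ A :=
  (NonUnitalStarAlgebra.adjoin ℂ s).topologicalClosure

lemma subset_cstarGen {A : Type u} [NonUnitalCStarAlgebra A] (s : Set A) :
    s ⊆ (cstarGen s : Set A) :=
  (NonUnitalStarAlgebra.subset_adjoin ℂ s).trans
    (NonUnitalStarSubalgebra.le_topologicalClosure _)

instance isClosed_cstarGen {A : Type u} [NonUnitalCStarAlgebra A] (s : Set A) :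
    IsClosed (cstarGen s : Set A) :=
  NonUnitalStarSubalgebra.isClosed_topologicalClosure _

/-- A set generates `A` if its image under an isometric `*`-homomorphism `e` generates a C*-algebra
that contains the range of `e`. -/
lemma cstarGen_eq_top_of_isometry {A : Type u} {B : Type v} [NonUnitalCStarAlgebra A]
    [NonUnitalCStarAlgebra B] (e : A →⋆ₙₐ[ℂ] B) (he : Isometry e) (s : Set A)
    (h : ∀ a, e a ∈ cstarGen (e '' s)) : cstarGen s = ⊤ := by
  have hcl : IsClosed ((cstarGen s).map e : Set B) := by
    rw [NonUnitalStarSubalgebra.coe_map]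
    exact he.isClosedEmbedding.isClosedMap _ (isClosed_cstarGen s)
  have hle : cstarGen (e '' s) ≤ (cstarGen s).map e := by
    apply NonUnitalStarSubalgebra.topologicalClosure_minimal _ _ hcl
    apply NonUnitalStarAlgebra.adjoin_le
    rw [NonUnitalStarSubalgebra.coe_map]
    exact Set.image_mono (subset_cstarGen s)
  rw [eq_top_iff]
  intro a _
  obtain ⟨b, hb, hab⟩ := NonUnitalStarSubalgebra.mem_map.1 (hle (h a))
  rwa [← he.injective hab]

/-! ### Replacing a C*-algebra by an isomorphic one in a smaller universe -/

lemma small_adjoin {A : Type v} [NonUnitalCStarAlgebra A] (s : Set A) [Small.{u} s] :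
    Small.{u} (NonUnitalStarAlgebra.adjoin ℂ s) := by
  have hs : Small.{u} (s ∪ star s : Set A) := by
    have : Small.{u} (star s : Set A) := by
      rw [← Set.image_star]
      infer_instance
    infer_instance
  have h1 : Small.{u} (Subsemigroup.closure (s ∪ star s) : Set A) := by
    let f : FreeSemigroup (Shrink.{u} (s ∪ star s : Set A)) →ₙ* A :=
      FreeSemigroup.lift fun x => ((equivShrink (s ∪ star s : Set A)).symm x).1
    refine small_subset (s := Set.range f) ?_
    have : Subsemigroup.closure (s ∪ star s) ≤ MulHom.srange f := by
      rw [Subsemigroup.closure_le]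
      intro x hx
      exact ⟨FreeSemigroup.of (equivShrink _ ⟨x, hx⟩), by simp [f]⟩
    intro x hx
    exact this hx
  let g : (Shrink.{u} (Subsemigroup.closure (s ∪ star s) : Set A) →₀ ℂ) →ₗ[ℂ] A :=
    Finsupp.linearCombination ℂ fun x =>
      ((equivShrink (Subsemigroup.closure (s ∪ star s) : Set A)).symm x).1
  refine small_subset (s := Set.range g) ?_
  intro x hx
  have hx' : x ∈ (NonUnitalStarAlgebra.adjoin ℂ s).toSubmodule := hx
  rw [NonUnitalStarAlgebra.adjoin_eq_span] at hx'
  have : Submodule.span ℂ (Subsemigroup.closure (s ∪ star s) : Set A) ≤ LinearMap.range g := by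
    rw [Submodule.span_le]
    intro x hx
    exact ⟨Finsupp.single (equivShrink _ ⟨x, hx⟩) 1, by simp [g]⟩
  exact this hx'

instance small_cstarGen {A : Type v} [NonUnitalCStarAlgebra A] (s : Set A) [Small.{u} s] :
    Small.{u} (cstarGen s) := by
  have h0 := small_adjoin.{u} s
  let S := Shrink.{u} (NonUnitalStarAlgebra.adjoin ℂ s)
  let c : S → A := fun x => ((equivShrink (NonUnitalStarAlgebra.adjoin ℂ s)).symm x).1
  let P : (ℕ → S) → A → Prop := fun f x => Filter.Tendsto (fun n => c (f n)) Filter.atTop (nhds x)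
  let L : {f : ℕ → S // ∃ x, P f x} → A := fun f => f.2.choose
  refine small_subset (s := Set.range L) ?_
  intro x hx
  have hx' : x ∈ closure (NonUnitalStarAlgebra.adjoin ℂ s : Set A) := hx
  obtain ⟨f, hf, hlim⟩ := mem_closure_iff_seq_limit.1 hx'
  have hP : P (fun n => equivShrink _ ⟨f n, hf n⟩) x := by
    simpa [P, c] using hlim
  exact ⟨⟨_, x, hP⟩, tendsto_nhds_unique (Exists.choose_spec (⟨x, hP⟩ : ∃ x, P _ x)) hP⟩

section Transport

variable (X : Type v) [NonUnitalCStarAlgebra X] [Small.{u} X]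

instance : Star (Shrink.{u} X) := ⟨fun x => equivShrink X (star ((equivShrink X).symm x))⟩

@[simp] lemma shrink_symm_star (x : Shrink.{u} X) :
    (equivShrink X).symm (star x) = star ((equivShrink X).symm x) := by
  simp [Star.star]

/-- The canonical bijection `Shrink X → X` as a non-unital ring homomorphism. -/
def shrinkRingHom : Shrink.{u} X →ₙ+* X where
  toFun := (equivShrink X).symm
  map_mul' := equivShrink_symm_mul
  map_zero' := equivShrink_symm_zero
  map_add' := equivShrink_symm_add

/-- The C*-algebra structure of `X`, carried over to the copy `Shrink X` of `X` along the canonical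
bijection. -/
instance : NonUnitalNormedRing (Shrink.{u} X) :=
  NonUnitalNormedRing.induced _ X (shrinkRingHom X) (equivShrink X).symm.injective

lemma shrink_norm_def (x : Shrink.{u} X) : ‖x‖ = ‖(equivShrink X).symm x‖ := rfl

lemma shrink_isometry : Isometry ((equivShrink X).symm : Shrink.{u} X → X) :=
  fun _ _ => rfl

instance : NonUnitalCStarAlgebra (Shrink.{u} X) where
  star_involutive x := (equivShrink X).symm.injective (by simp)
  star_mul x y := (equivShrink X).symm.injective (by simp)
  star_add x y := (equivShrink X).symm.injective (by simp)
  toCompleteSpace :=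
    ((shrink_isometry X).isUniformInducing.completeSpace_congr
      (equivShrink X).symm.surjective).2 inferInstance
  norm_mul_self_le x := by
    simp only [shrink_norm_def, equivShrink_symm_mul, shrink_symm_star]
    exact CStarRing.norm_mul_self_le _
  norm_smul_le c x := by
    simp only [shrink_norm_def, equivShrink_symm_smul]
    exact norm_smul_le _ _
  smul_assoc c x y := (equivShrink X).symm.injective (by simp [smul_mul_assoc])
  smul_comm c x y := (equivShrink X).symm.injective (by simp [mul_smul_comm])
  star_smul c x := (equivShrink X).symm.injective (by simp)

/-- The canonical bijection `Shrink X → X` as a `*`-homomorphism. -/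
def shrinkHom : Shrink.{u} X →⋆ₙₐ[ℂ] X where
  toFun := (equivShrink X).symm
  map_smul' c x := by simp
  map_mul' := equivShrink_symm_mul
  map_zero' := equivShrink_symm_zero
  map_add' := equivShrink_symm_add
  map_star' := shrink_symm_star X

end Transport

/-! ### The minimal tensor product -/

/-- The Hilbert space tensor product. -/
abbrev HilbertTensor (H K : Type u) [NormedAddCommGroup H] [InnerProductSpace ℂ H]
    [NormedAddCommGroup K] [InnerProductSpace ℂ K] : Type u :=
  UniformSpace.Completion (H ⊗[ℂ] K)

/-- The operator `S ⊗ T` on the Hilbert space tensor product. -/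
def opTensor {H K : Type u} [NormedAddCommGroup H] [InnerProductSpace ℂ H]
    [NormedAddCommGroup K] [InnerProductSpace ℂ K] (S : H →L[ℂ] H) (T : K →L[ℂ] K) :
    HilbertTensor H K →L[ℂ] HilbertTensor H K :=
  (TensorProduct.mapL S T).completion

lemma norm_opTensor_le {H K : Type u} [NormedAddCommGroup H] [InnerProductSpace ℂ H]
    [NormedAddCommGroup K] [InnerProductSpace ℂ K] (S : H →L[ℂ] H) (T : K →L[ℂ] K) :
    ‖opTensor S T‖ ≤ ‖S‖ * ‖T‖ := by
  refine ContinuousLinearMap.opNorm_le_bound _ (by positivity) fun x => ?_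
  induction x using UniformSpace.Completion.induction_on with
  | hp => exact isClosed_le (by fun_prop) (by fun_prop)
  | ih x =>
    simp only [opTensor, ContinuousLinearMap.completion_apply_coe,
      UniformSpace.Completion.norm_coe]
    exact (ContinuousLinearMap.le_opNorm _ _).trans
      (mul_le_mul_of_nonneg_right (TensorProduct.norm_mapL_le S T) (norm_nonneg _))

/-- A pair of representations `ξ₁ : A → B(H₁)` and `ξ₂ : B → B(H₂)` on Hilbert spaces. -/
structure RepPair (A B : Type u) [NonUnitalCStarAlgebra A] [NonUnitalCStarAlgebra B] where
  H₁ : Type u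
  H₂ : Type u
  [normed₁ : NormedAddCommGroup H₁]
  [inner₁ : InnerProductSpace ℂ H₁]
  [complete₁ : CompleteSpace H₁]
  [normed₂ : NormedAddCommGroup H₂]
  [inner₂ : InnerProductSpace ℂ H₂]
  [complete₂ : CompleteSpace H₂]
  ξ₁ : A →⋆ₙₐ[ℂ] (H₁ →L[ℂ] H₁)
  ξ₂ : B →⋆ₙₐ[ℂ] (H₂ →L[ℂ] H₂)

attribute [instance] RepPair.normed₁ RepPair.inner₁ RepPair.complete₁ RepPair.normed₂
  RepPair.inner₂ RepPair.complete₂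

/-- The C*-algebra `B(H₁ ⊗ H₂)` of bounded operators on the Hilbert space tensor product. -/
def RepPair.Op {A B : Type u} [NonUnitalCStarAlgebra A] [NonUnitalCStarAlgebra B]
    (r : RepPair A B) : Type u :=
  HilbertTensor r.H₁ r.H₂ →L[ℂ] HilbertTensor r.H₁ r.H₂

instance {A B : Type u} [NonUnitalCStarAlgebra A] [NonUnitalCStarAlgebra B]
    (r : RepPair A B) : CStarAlgebra r.Op :=
  inferInstanceAs (CStarAlgebra (HilbertTensor r.H₁ r.H₂ →L[ℂ] HilbertTensor r.H₁ r.H₂))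

section MinTensor

variable (A B : Type u) [NonUnitalCStarAlgebra A] [NonUnitalCStarAlgebra B]

/-- The C*-algebra of bounded families of operators on `H₁ ⊗ H₂`, indexed by all pairs of
representations of `A` and `B`, with the supremum norm. -/
abbrev RepProduct : Type (u + 1) :=
  lp (fun r : RepPair A B => r.Op) ∞

variable {A B} in
/-- The family `(ξ₁(a) ⊗ ξ₂(b))` indexed by all pairs of representations `(ξ₁, ξ₂)`. -/
def elemTensor (a : A) (b : B) : RepProduct A B :=
  ⟨fun r => opTensor (r.ξ₁ a) (r.ξ₂ b), memℓp_infty ⟨‖a‖ * ‖b‖, by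
    rintro _ ⟨r, rfl⟩
    exact (norm_opTensor_le _ _).trans
      (mul_le_mul (NonUnitalStarAlgHom.norm_apply_le r.ξ₁ a)
        (NonUnitalStarAlgHom.norm_apply_le r.ξ₂ b) (norm_nonneg _) (norm_nonneg _))⟩⟩

/-- The minimal tensor product of the C*-algebras `A` and `B`: the completion of `A ⊙ B` with
respect to the norm `sup ‖(ξ₁ ⊗ ξ₂)(·)‖` over all pairs of representations `ξ₁` of `A` and `ξ₂` of
`B`. It is realised as the closed span of the families `(ξ₁(a) ⊗ ξ₂(b))`, and `Shrink` replaces it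
by a copy of itself in the universe of `A` and `B`. -/
def MinTensor : Type u :=
  Shrink.{u} (cstarGen (Set.range fun p : A × B => elemTensor p.1 p.2))

instance : NonUnitalCStarAlgebra (MinTensor A B) :=
  inferInstanceAs (NonUnitalCStarAlgebra
    (Shrink.{u} (cstarGen (Set.range fun p : A × B => elemTensor p.1 p.2))))

variable {A B} in
/-- The elementary tensor `a ⊗ b` in the minimal tensor product. -/
def tmin (a : A) (b : B) : MinTensor A B :=
  equivShrink _ ⟨elemTensor a b, subset_cstarGen _ ⟨(a, b), rfl⟩⟩

end MinTensor

/-! ### The category `C_N` -/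

/-- A C*-algebra together with an `N × N`-matrix over it. -/
structure MatPair (N : ℕ) where
  alg : Type u
  [str : NonUnitalCStarAlgebra alg]
  mat : Matrix (Fin N) (Fin N) alg

attribute [instance] MatPair.str

/-- The set of entries of a matrix. -/
def entries {N : ℕ} {A : Type u} (M : Matrix (Fin N) (Fin N) A) : Set A :=
  Set.range fun p : Fin N × Fin N => M p.1 p.2

lemma mem_entries {N : ℕ} {A : Type u} (M : Matrix (Fin N) (Fin N) A) (i j : Fin N) :
    M i j ∈ entries M := ⟨(i, j), rfl⟩

/-- Objects `(D, M)` of the category `C_N`: the C*-algebra `D` is generated by the entries of the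
`N × N`-matrix `M`. -/
structure Obj (N : ℕ) extends MatPair.{u} N where
  generated : cstarGen (entries mat) = ⊤

/-- Arrows of the category `C_N`: `*`-homomorphisms that send the entries of the first matrix to the
corresponding entries of the second one. -/
@[ext]
structure Arrow {N : ℕ} (X : Obj.{u} N) (Y : Obj.{v} N) where
  hom : X.alg →⋆ₙₐ[ℂ] Y.alg
  map_mat : ∀ i j, hom (X.mat i j) = Y.mat i j

instance (N : ℕ) : Category.{u} (Obj.{u} N) where
  Hom X Y := Arrow X Y
  id X := ⟨NonUnitalStarAlgHom.id ℂ X.alg, fun _ _ => rfl⟩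
  comp f g := ⟨g.hom.comp f.hom, fun i j => by simp [f.map_mat, g.map_mat]⟩

/-- For a matrix `M` over any C*-algebra, the object `(C*(m_ij | i, j), M)`. -/
def MatPair.gen {N : ℕ} (X : MatPair.{u} N) : Obj.{u} N where
  alg := cstarGen (entries X.mat)
  mat := fun i j => ⟨X.mat i j, subset_cstarGen _ (mem_entries _ i j)⟩
  generated := by
    refine cstarGen_eq_top_of_isometry
      (NonUnitalStarSubalgebraClass.subtype (cstarGen (entries X.mat))) isometry_subtype_coe _ ?_
    intro a
    have : (NonUnitalStarSubalgebraClass.subtype (cstarGen (entries X.mat)) '' entries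
        fun i j => (⟨X.mat i j, subset_cstarGen _ (mem_entries _ i j)⟩ :
          cstarGen (entries X.mat))) = entries X.mat := by
      unfold entries
      rw [← Set.range_comp]
      rfl
    rw [this]
    exact a.2

/-- A copy of an object in another universe. -/
def Obj.shrink {N : ℕ} (X : Obj.{v} N) [Small.{u} X.alg] : Obj.{u} N where
  alg := Shrink.{u} X.alg
  mat := fun i j => equivShrink _ (X.mat i j)
  generated := by
    refine cstarGen_eq_top_of_isometry (shrinkHom X.alg) (shrink_isometry X.alg) _ ?_
    intro a
    have : (shrinkHom.{u} X.alg '' entries fun i j => equivShrink _ (X.mat i j)) =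
        entries X.mat := by
      unfold entries
      rw [← Set.range_comp]
      simp [shrinkHom, Function.comp_def]
    rw [this, X.generated]
    trivial

/-- The object `(ℂ, 1)`, where `1` is the identity matrix. -/
def oneObj (N : ℕ) [NeZero N] : Obj.{0} N where
  alg := ℂ
  mat := 1
  generated := by
    rw [eq_top_iff]
    intro z _
    have h : (1 : ℂ) ∈ cstarGen (entries (1 : Matrix (Fin N) (Fin N) ℂ)) :=
      subset_cstarGen _ ⟨(0, 0), by simp⟩
    simpa using SMulMemClass.smul_mem z h

/-- An arrow to `(ℂ, 1)`, as a `*`-homomorphism to `ℂ`. -/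
def Arrow.toComplex {N : ℕ} [NeZero N] {X : Obj.{u} N} (ν : Arrow X (oneObj N)) : X.alg →⋆ₙₐ[ℂ] ℂ :=
  ν.hom

/-! ### Woronowicz's product of matrices and compact matrix quantum groups -/

/-- The matrix over `A ⊗ B` with entries `∑ k, x i k ⊗ y k j`. -/
def wprod {N : ℕ} {A B : Type u} [NonUnitalCStarAlgebra A] [NonUnitalCStarAlgebra B]
    (x : Matrix (Fin N) (Fin N) A) (y : Matrix (Fin N) (Fin N) B) :
    Matrix (Fin N) (Fin N) (MinTensor A B) :=
  fun i j => ∑ k, tmin (x i k) (y k j)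

/-- `e` is a (two-sided) multiplicative identity of `A`. -/
def IsIdentity {A : Type u} [Mul A] (e : A) : Prop := ∀ a, e * a = a ∧ a * e = a

/-- `(A, u)` is a compact matrix quantum group: `A` is unital with unit `e`, the matrix `u` is
unitary, the matrix `u^(*)` of adjoints of the entries is invertible, and there is a unital
`*`-homomorphism `Δ : A → A ⊗ A` with `Δ (u_ij) = ∑ k, u_ik ⊗ u_kj`. -/
def IsCMQG {N : ℕ} (G : Obj.{u} N) : Prop :=
  ∃ e : G.alg, IsIdentity e ∧
    (G.mat * G.mat.conjTranspose = Matrix.diagonal fun _ => e) ∧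
    (G.mat.conjTranspose * G.mat = Matrix.diagonal fun _ => e) ∧
    (∃ v : Matrix (Fin N) (Fin N) G.alg,
      (G.mat.map star * v = Matrix.diagonal fun _ => e) ∧
      (v * G.mat.map star = Matrix.diagonal fun _ => e)) ∧
    ∃ Δ : G.alg →⋆ₙₐ[ℂ] MinTensor G.alg G.alg,
      IsIdentity (Δ e) ∧ ∀ i j, Δ (G.mat i j) = wprod G.mat G.mat i j

/-! ### Easy quantum groups -/

/-- The colours of the points of a partition. -/
inductive Colour
  | white
  | black

/-- A two-coloured partition `p ∈ P(k, l)`: a partition of the set of `k` upper and `l` lower points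
into blocks (given by the equivalence relation of lying in the same block), together with a
colouring of the points. -/
structure Partition where
  k : ℕ
  l : ℕ
  upper : Fin k → Colour
  lower : Fin l → Colour
  blocks : Setoid (Fin k ⊕ Fin l)

/-- `x^ω`: the element itself for a white point, its adjoint for a black point. -/
def Colour.pow {D : Type u} [Star D] (x : D) : Colour → D
  | white => x
  | black => star x

open Classical in
/-- `δ_p(t, t')`, which is `1` if the labelling of the upper points by `t` and of the lower points by
`t'` is constant on every block of `p`, and `0` otherwise. -/
def Partition.delta {N : ℕ} (p : Partition) (t : Fin p.k → Fin N) (t' : Fin p.l → Fin N) : ℂ :=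
  if ∀ a b, p.blocks a b → Sum.elim t t' a = Sum.elim t t' b then 1 else 0

/-- The quantum group relations associated to the partition `p` and the matrix `x`. The products are
ordered, and empty products are `1`. -/
def Partition.Rel {N : ℕ} {D : Type u} [CStarAlgebra D] (p : Partition)
    (x : Matrix (Fin N) (Fin N) D) : Prop :=
  ∀ (γ : Fin p.k → Fin N) (γ' : Fin p.l → Fin N),
    ∑ t : Fin p.k → Fin N,
        p.delta t γ' • (List.ofFn fun i => (p.upper i).pow (x (t i) (γ i))).prod =
      ∑ t' : Fin p.l → Fin N,
        p.delta γ t' • (List.ofFn fun i => (p.lower i).pow (x (γ' i) (t' i))).prod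

/-- The partition in `P(2, 0)` whose two points form one block, with colours `c` and `d`. -/
def upperPair (c d : Colour) : Partition := ⟨2, 0, ![c, d], ![], ⊤⟩

/-- The partition in `P(0, 2)` whose two points form one block, with colours `c` and `d`. -/
def lowerPair (c d : Colour) : Partition := ⟨0, 2, ![], ![c, d], ⊤⟩

/-- The four pair partitions whose two points are on the same line and coloured differently. -/
def basicPairs : Set Partition :=
  {lowerPair .white .black, lowerPair .black .white,
    upperPair .white .black, upperPair .black .white}

/-- A matrix over a unital C*-algebra that satisfies the relations of all partitions in `S`. -/
structure RelModel (N : ℕ) (S : Set Partition) where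
  D : Type u
  [str : CStarAlgebra D]
  x : Matrix (Fin N) (Fin N) D
  rel : ∀ p ∈ S, p.Rel x

attribute [instance] RelModel.str

lemma norm_one_le {D : Type u} [CStarAlgebra D] : ‖(1 : D)‖ ≤ 1 := by
  have h : ‖(1 : D)‖ * ‖(1 : D)‖ = ‖(1 : D)‖ := by
    simpa using (CStarRing.norm_star_mul_self (x := (1 : D))).symm
  nlinarith [norm_nonneg (1 : D)]

/-- The entries of a model have norm at most one, because its matrix is unitary. -/
lemma RelModel.norm_le_one {N : ℕ} {S : Set Partition} (hS : basicPairs ⊆ S) (m : RelModel.{u} N S)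
    (i j : Fin N) : ‖m.x i j‖ ≤ 1 := by
  have h := m.rel (lowerPair .white .black) (hS (by simp [basicPairs])) ![] ![i, i]
  have h1 : (1 : m.D) = ∑ k, m.x i k * star (m.x i k) := by
    change ∑ t : Fin 0 → Fin N, _ = ∑ t' : Fin 2 → Fin N, _ at h
    rw [← (finTwoArrowEquiv (Fin N)).symm.sum_comp (fun t' : Fin 2 → Fin N => _),
      Fintype.sum_prod_type] at h
    have hd : ∀ a b : Fin N, (lowerPair .white .black).delta (N := N) ![]
        ((finTwoArrowEquiv (Fin N)).symm (a, b)) = if a = b then 1 else 0 := by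
      intro a b
      unfold Partition.delta
      congr 1
      have h01 : ∀ x y, (lowerPair .white .black).blocks x y := fun _ _ => trivial
      simp [lowerPair, finTwoArrowEquiv, eq_comm] at h01 ⊢
      simp [h01]
    simp only [hd] at h
    simpa [lowerPair, Partition.delta, Colour.pow, Setoid.top_def, List.ofFn_succ, eq_comm] using h
  let _ := CStarAlgebra.spectralOrder m.D
  have := CStarAlgebra.spectralOrderedRing m.D
  have h2 : m.x i j * star (m.x i j) ≤ 1 := by
    rw [h1]
    exact Finset.single_le_sum (f := fun k => m.x i k * star (m.x i k))
      (fun k _ => mul_star_self_nonneg _) (Finset.mem_univ j)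
  have h3 := (CStarAlgebra.norm_le_norm_of_nonneg_of_le (mul_star_self_nonneg _) h2).trans
    norm_one_le
  rw [CStarRing.norm_self_mul_star] at h3
  nlinarith [norm_nonneg (m.x i j)]

/-- The family of the matrices of all models of the relations of `S`, as a matrix over the C*-algebra
of bounded families. -/
def universalPair (N : ℕ) (S : Set Partition) (hS : basicPairs ⊆ S) : MatPair.{u + 1} N where
  alg := lp (fun m : RelModel.{u} N S => m.D) ∞
  mat := fun i j => ⟨fun m => m.x i j, memℓp_infty ⟨1, by
    rintro _ ⟨m, rfl⟩
    exact m.norm_le_one hS i j⟩⟩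

instance (N : ℕ) (S : Set Partition) (hS : basicPairs ⊆ S) :
    Small.{u} (universalPair.{u} N S hS).gen.alg :=
  have : Small.{u} (entries (universalPair.{u} N S hS).mat) := by
    unfold entries
    infer_instance
  small_cstarGen.{u} (entries (universalPair.{u} N S hS).mat)

/-- The easy quantum group `G_N(S) = (C(G_N(S)), u)`: the universal C*-algebra generated by the
entries `u_ij` subject to the relations of all partitions in `S`. It is realised inside the product
of all models of these relations, that is, with the norm
`‖P(u)‖ = sup ‖P(x)‖` over all models `x`; `Shrink` replaces it by a copy of itself in the universe
of the models. -/
def easyQG (N : ℕ) (S : Set Partition) (hS : basicPairs ⊆ S) : Obj.{u} N :=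
  (universalPair.{u} N S hS).gen.shrink

/-! ### The sequence of models -/

/-- The pairs `(B₁^{⊗ (n+1)}, M_{n+1})` where `M_{n+2} = M_{n+1} ⦶ M₁`. -/
def power {N : ℕ} (B : Obj.{u} N) : ℕ → MatPair.{u} N
  | 0 => B.toMatPair
  | n + 1 => ⟨MinTensor (power B n).alg B.alg, wprod (power B n).mat B.mat⟩

/-- The object `(B_{n+1}, M_{n+1})`, where `B_{n+1} ⊆ B₁^{⊗ (n+1)}` is the C*-algebra generated by
the entries of `M_{n+1}`. -/
def model {N : ℕ} (B : Obj.{u} N) (n : ℕ) : Obj.{u} N := (power B n).gen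

/-- The inclusion `B_{n+1} ⊆ B₁^{⊗ (n+1)}`. -/
def model.incl {N : ℕ} (B : Obj.{u} N) (n : ℕ) : (model B n).alg →⋆ₙₐ[ℂ] (power B n).alg :=
  NonUnitalStarSubalgebraClass.subtype (cstarGen (entries (power B n).mat))

end

end CQG

namespace CQG

noncomputable section

/-! ### `*`-homomorphisms into bounded families -/

section Families

universe w₁ w₂ w₃ w₄

variable {ι : Type w₁} {D : ι → Type w₂} [∀ i, NonUnitalCStarAlgebra (D i)]

/-! Since `ν` sends `M₁` to the identity matrix, `id ⊗ ν` sends `M_n ⦶ M₁` to `M_n`; this gives the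
inverse system. Every `M_n` is a model because the relations survive `⦶`
(`Partition.RelWith.wprod`): a word in the entries of `x ⦶ y` is a sum over a middle multi-index of
a word in `x` tensor a word in `y`, and `δ_p` is carried first across `x`, then across `y`.

An arrow of `C_N` is determined by the generators, so there is at most one between two objects.
Hence the limit is simply the C*-subalgebra of the product of the `B_n` generated by the entries of
the family `(M_n)`. The arrows from `C(G_N(Π))` to all `B_n` bound these entries and induce the
arrow to the limit. Unit, unitarity and invertibility of `u^(*)` then descend along this arrow.

What remains is the comultiplication (`power.exists_comul`). Associativity of `⊗` maps `B₁^{⊗(n+m)}`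
to `B₁^{⊗n} ⊗ B₁^{⊗m}` and `M_{n+m}` to `M_n ⦶ M_m` (`power.exists_split`), so the `(n, m)`
component of `Δ` has to be the component `n + m` of the limit. These components assemble to a map
into `B_∞ ⊗ B_∞` for two reasons. Jointly injective representations of the two factors are jointly
injective on the minimal tensor product (`MinTensor.eq_zero_of_separating`, by slice maps). And a
`*`-homomorphism that sends generators into the range of an injective one factors through it,
because that range is closed (`exists_lift`). The slice maps rest on the fact that representations
separate points (`Rep.ext`, by the GNS construction). -/

/-- Evaluation of a bounded family at an index. -/
def lpEval (i : ι) : lp D ∞ →⋆ₙₐ[ℂ] D i where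
  toFun x := x i
  map_smul' _ _ := rfl
  map_zero' := rfl
  map_add' _ _ := rfl
  map_mul' _ _ := rfl
  map_star' _ := rfl

/-- A family of `*`-homomorphisms as one `*`-homomorphism to the bounded families. -/
def lpHom {E : Type w₃} [NonUnitalCStarAlgebra E] (f : ∀ i, E →⋆ₙₐ[ℂ] D i) : E →⋆ₙₐ[ℂ] lp D ∞ where
  toFun x := ⟨fun i => f i x, memℓp_infty ⟨‖x‖, by
    rintro _ ⟨i, rfl⟩
    exact NonUnitalStarAlgHom.norm_apply_le (f i) x⟩⟩
  map_smul' c x := by ext i; exact map_smul (f i) c x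
  map_zero' := by ext i; exact map_zero (f i)
  map_add' x y := by ext i; exact map_add (f i) x y
  map_mul' x y := by ext i; exact map_mul (f i) x y
  map_star' x := by ext i; exact map_star (f i) x

lemma lpHom_apply {E : Type w₃} [NonUnitalCStarAlgebra E] (f : ∀ i, E →⋆ₙₐ[ℂ] D i) (x : E) (i : ι) :
    lpHom f x i = f i x := rfl

lemma continuous_starHom {E : Type w₃} {F : Type w₄} [NonUnitalCStarAlgebra E]
    [NonUnitalCStarAlgebra F] (f : E →⋆ₙₐ[ℂ] F) : Continuous f :=
  AddMonoidHomClass.continuous_of_bound f 1 fun x => by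
    simpa using NonUnitalStarAlgHom.norm_apply_le f x

lemma isClosed_range_of_injective {E : Type w₃} {F : Type w₄} [NonUnitalCStarAlgebra E]
    [NonUnitalCStarAlgebra F] (f : E →⋆ₙₐ[ℂ] F) (hf : Function.Injective f) :
    IsClosed (Set.range f) :=
  (NonUnitalStarAlgHom.isometry f hf).isClosedEmbedding.isClosed_range

lemma lpHom_injective {E : Type w₃} [NonUnitalCStarAlgebra E] (f : ∀ i, E →⋆ₙₐ[ℂ] D i)
    (hf : ∀ x, (∀ i, f i x = 0) → x = 0) : Function.Injective (lpHom f) := by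
  rw [injective_iff_map_eq_zero]
  intro x hx
  exact hf x fun i => by rw [← lpHom_apply f x i, hx]; rfl

/-- A closed `*`-subalgebra that contains a generating set is everything. -/
lemma eq_top_of_generates {E : Type w₃} [NonUnitalCStarAlgebra E] {s : Set E} (hs : cstarGen s = ⊤)
    (K : NonUnitalStarSubalgebra ℂ E) (hK : IsClosed (K : Set E)) (h : s ⊆ K) (x : E) : x ∈ K := by
  have h1 : cstarGen s ≤ K :=
    NonUnitalStarSubalgebra.topologicalClosure_minimal _ (NonUnitalStarAlgebra.adjoin_le h) hK
  rw [hs] at h1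
  exact h1 trivial

/-- A `*`-homomorphism maps into a closed `*`-subalgebra if it does so on generators. -/
lemma map_mem_of_generates {E : Type w₃} {F : Type w₄} [NonUnitalCStarAlgebra E]
    [NonUnitalCStarAlgebra F] {s : Set E} (hs : cstarGen s = ⊤) (f : E →⋆ₙₐ[ℂ] F)
    (K : NonUnitalStarSubalgebra ℂ F) (hK : IsClosed (K : Set F)) (h : ∀ x ∈ s, f x ∈ K) (x : E) :
    f x ∈ K :=
  eq_top_of_generates hs (K.comap f)
    (hK.preimage (continuous_starHom f)) h x

/-- Lifting a family of `*`-homomorphisms through a jointly injective family. -/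
theorem exists_lift {E : Type w₃} {T : Type w₄} [NonUnitalCStarAlgebra E] [NonUnitalCStarAlgebra T]
    (Φ : ∀ i, T →⋆ₙₐ[ℂ] D i) (hΦ : ∀ x, (∀ i, Φ i x = 0) → x = 0) (Ψ : ∀ i, E →⋆ₙₐ[ℂ] D i)
    {s : Set E} (hs : cstarGen s = ⊤) (h : ∀ x ∈ s, ∃ y, ∀ i, Φ i y = Ψ i x) :
    ∃ θ : E →⋆ₙₐ[ℂ] T, ∀ x y, (∀ i, Φ i y = Ψ i x) → θ x = y := by
  have hinj := lpHom_injective Φ hΦ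
  -- An injective `*`-homomorphism is isometric, so the range of `lpHom Φ` is a closed
  -- `*`-subalgebra; it contains the images of the generators under `lpHom Ψ`, hence all images.
  have hmem : ∀ x, ∃ y, lpHom Φ y = lpHom Ψ x := by
    intro x
    refine map_mem_of_generates hs (lpHom Ψ) (NonUnitalStarAlgHom.range (lpHom Φ)) ?_ ?_ x
    · simpa using isClosed_range_of_injective _ hinj
    · intro x hx
      obtain ⟨y, hy⟩ := h x hx
      exact ⟨y, by ext i; exact hy i⟩
  choose θ hθ using hmem
  refine ⟨{ toFun := θ
            map_smul' := fun c x => hinj ?_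
            map_zero' := hinj ?_
            map_add' := fun x y => hinj ?_
            map_mul' := fun x y => hinj ?_
            map_star' := fun x => hinj ?_ }, fun x y h => hinj ?_⟩
  · simp [hθ]
  · simp [hθ]
  · simp [hθ]
  · simp [hθ]
  · rw [hθ, map_star, map_star, hθ]
  · change lpHom Φ (θ x) = _
    rw [hθ]
    ext i
    exact (h i).symm

end Families

/-! ### Representations separate the points of a C*-algebra -/

/-- A representation of a C*-algebra on a Hilbert space. -/
structure Rep (A : Type u) [NonUnitalCStarAlgebra A] where
  H : Type u
  [normed : NormedAddCommGroup H]
  [innerProduct : InnerProductSpace ℂ H]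
  [complete : CompleteSpace H]
  ξ : A →⋆ₙₐ[ℂ] (H →L[ℂ] H)

attribute [instance] Rep.normed Rep.innerProduct Rep.complete

/-- The pull-back of a representation along a `*`-homomorphism. -/
def Rep.comap {A B : Type u} [NonUnitalCStarAlgebra A] [NonUnitalCStarAlgebra B] (r : Rep B)
    (f : A →⋆ₙₐ[ℂ] B) : Rep A := ⟨r.H, r.ξ.comp f⟩

open scoped ComplexOrder ComplexStarModule in
/-- A nonzero positive element is detected by a positive functional. -/
lemma exists_positive_functional {A : Type u} [NonUnitalCStarAlgebra A] [PartialOrder A]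
    [StarOrderedRing A] {a : A} (ha : 0 ≤ a) (h0 : a ≠ 0) : ∃ f : A →ₚ[ℂ] ℂ, f a ≠ 0 := by
  let C : ProperCone ℝ A :=
    { carrier := {x | 0 ≤ x}
      add_mem' := fun hx hy => add_nonneg hx hy
      zero_mem' := le_refl (0 : A)
      smul_mem' := fun c x hx => smul_nonneg c.2 hx
      isClosed' := CStarAlgebra.isClosed_nonneg }
  have hC : ∀ x, x ∈ C ↔ 0 ≤ x := fun x => Iff.rfl
  have hna : -a ∉ C := by
    rw [hC]
    intro h
    exact h0 (le_antisymm (by simpa using h) ha)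
  -- Hahn–Banach: `f` is nonnegative on the closed cone of positive elements and negative at `-a`.
  obtain ⟨f, hf, hfa⟩ := ProperCone.hyperplane_separation_point C hna
  -- The complexification of `f ∘ Re` agrees with `f` on self-adjoint `x`, since there the real part
  -- of `i x` vanishes.
  let g : A →ₗ[ℝ] ℝ :=
    f.toLinearMap ∘ₗ (selfAdjoint.submodule ℝ A).subtype ∘ₗ (realPart : A →ₗ[ℝ] selfAdjoint A)
  have hg : ∀ x, g x = f (ℜ x : A) := fun x => rfl
  let F : A →ₗ[ℂ] ℂ := Module.Dual.extendRCLike g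
  have hF : ∀ x : A, IsSelfAdjoint x → F x = (f x : ℂ) := by
    intro x hx
    have h1 : F x = (g x : ℂ) - Complex.I * (g (Complex.I • x) : ℂ) :=
      Module.Dual.extendRCLike_apply g x
    rw [h1, hg, hg, realPart_I_smul, hx.imaginaryPart, hx.coe_realPart]
    simp
  refine ⟨PositiveLinearMap.mk₀ F fun x hx => ?_, ?_⟩
  · rw [hF x (IsSelfAdjoint.of_nonneg hx)]
    exact_mod_cast hf x hx
  · change F a ≠ 0
    rw [hF a (IsSelfAdjoint.of_nonneg ha)]
    have : f a ≠ 0 := by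
      rw [map_neg, neg_lt_zero] at hfa
      exact hfa.ne'
    exact_mod_cast this

open scoped ComplexOrder in
/-- The representations of a C*-algebra separate its points. -/
theorem Rep.ext {A : Type u} [NonUnitalCStarAlgebra A] {x : A} (h : ∀ r : Rep A, r.ξ x = 0) :
    x = 0 := by
  by_contra hx
  let _ := CStarAlgebra.spectralOrder A
  have := CStarAlgebra.spectralOrderedRing A
  have h1 : x * star x ≠ 0 := by simpa using hx
  have h2 : star (x * star x) * (x * star x) ≠ 0 := by
    rwa [ne_eq, CStarRing.star_mul_self_eq_zero_iff]
  -- Without a unit there is no class of `1` to act on, so the class of `x^*` is used: `x` sends it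
  -- to the class of `x x^*`, whose squared norm is `f ((x x^*)^* (x x^*)) ≠ 0`.
  obtain ⟨f, hf⟩ := exists_positive_functional (star_mul_self_nonneg (x * star x)) h2
  have h3 := congrArg (fun T => T (f.toPreGNS (star x) : f.GNS)) (h ⟨f.GNS, f.gnsNonUnitalStarAlgHom⟩)
  simp only [PositiveLinearMap.gnsNonUnitalStarAlgHom_apply_coe] at h3
  have h4 : ‖(f.leftMulMapPreGNS x (f.toPreGNS (star x)) : f.GNS)‖ = 0 := by
    rw [h3]; simp
  rw [UniformSpace.Completion.norm_coe] at h4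
  have h5 := f.preGNS_norm_sq (f.leftMulMapPreGNS x (f.toPreGNS (star x)))
  rw [h4] at h5
  apply hf
  rw [← show f.ofPreGNS (f.leftMulMapPreGNS x (f.toPreGNS (star x))) = x * star x by simp, ← h5]
  simp

/-! ### Operators on Hilbert space tensor products -/

section HilbertSpaces

variable {H K : Type u} [NormedAddCommGroup H] [InnerProductSpace ℂ H]
  [NormedAddCommGroup K] [InnerProductSpace ℂ K]

/-- The vector `x ⊗ y` of the Hilbert space tensor product. -/
def vecTensor (x : H) (y : K) : HilbertTensor H K := ((x ⊗ₜ[ℂ] y : H ⊗[ℂ] K) : HilbertTensor H K)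

/-- The operator `x ↦ x ⊗ y`. -/
def tensorRight (H : Type u) [NormedAddCommGroup H] [InnerProductSpace ℂ H] (y : K) :
    H →L[ℂ] HilbertTensor H K :=
  UniformSpace.Completion.toComplL ∘L (TensorProduct.mkL ℂ H K).flip y

/-- The operator `y ↦ x ⊗ y`. -/
def tensorLeft (K : Type u) [NormedAddCommGroup K] [InnerProductSpace ℂ K] (x : H) :
    K →L[ℂ] HilbertTensor H K :=
  UniformSpace.Completion.toComplL ∘L TensorProduct.mkL ℂ H K x

lemma tensorRight_apply (x : H) (y : K) : tensorRight H y x = vecTensor x y := rfl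

lemma tensorLeft_apply (x : H) (y : K) : tensorLeft K x y = vecTensor x y := rfl

lemma opTensor_vecTensor (S : H →L[ℂ] H) (T : K →L[ℂ] K) (x : H) (y : K) :
    opTensor S T (vecTensor x y) = vecTensor (S x) (T y) := by
  simp [opTensor, vecTensor]

lemma inner_vecTensor (x x' : H) (y y' : K) :
    inner ℂ (vecTensor x y) (vecTensor x' y') = inner ℂ x x' * inner ℂ y y' := by
  rw [vecTensor, vecTensor, UniformSpace.Completion.inner_coe, TensorProduct.inner_tmul]

lemma norm_vecTensor (x : H) (y : K) : ‖vecTensor x y‖ = ‖x‖ * ‖y‖ := by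
  rw [vecTensor, UniformSpace.Completion.norm_coe, TensorProduct.norm_tmul]

lemma HilbertTensor.ext {F : Type*} [NormedAddCommGroup F] [NormedSpace ℂ F]
    {S T : HilbertTensor H K →L[ℂ] F} (h : ∀ x y, S (vecTensor x y) = T (vecTensor x y)) :
    S = T := by
  ext z
  induction z using UniformSpace.Completion.induction_on with
  | hp => exact isClosed_eq (by fun_prop) (by fun_prop)
  | ih z =>
    induction z using TensorProduct.induction_on with
    | zero => rw [UniformSpace.Completion.coe_zero, map_zero, map_zero]
    | tmul x y => exact h x y
    | add z w hz hw => rw [UniformSpace.Completion.coe_add, map_add, map_add, hz, hw]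

/-- The vectors `x ⊗ y` are total, so they suffice in both arguments of the inner product. -/
lemma HilbertTensor.op_ext {S T : HilbertTensor H K →L[ℂ] HilbertTensor H K}
    (h : ∀ x y x' y', inner ℂ (vecTensor x' y') (S (vecTensor x y)) =
      inner ℂ (vecTensor x' y') (T (vecTensor x y))) : S = T := by
  refine HilbertTensor.ext fun x y => ?_
  refine ext_inner_left ℂ fun z => ?_
  have key : (innerSL ℂ (S (vecTensor x y)) : HilbertTensor H K →L[ℂ] ℂ) =
      innerSL ℂ (T (vecTensor x y)) := by
    refine HilbertTensor.ext fun x' y' => ?_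
    rw [innerSL_apply_apply, innerSL_apply_apply, ← inner_conj_symm, h, inner_conj_symm]
  rw [← inner_conj_symm, ← inner_conj_symm z, ← innerSL_apply_apply, key, innerSL_apply_apply]

lemma opTensor_add_left (S S' : H →L[ℂ] H) (T : K →L[ℂ] K) :
    opTensor (S + S') T = opTensor S T + opTensor S' T := by
  refine HilbertTensor.ext fun x y => ?_
  rw [add_apply]
  simp only [opTensor_vecTensor]
  exact map_add (tensorRight H (T y)) (S x) (S' x)

lemma opTensor_add_right (S : H →L[ℂ] H) (T T' : K →L[ℂ] K) :
    opTensor S (T + T') = opTensor S T + opTensor S T' := by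
  refine HilbertTensor.ext fun x y => ?_
  rw [add_apply]
  simp only [opTensor_vecTensor]
  exact map_add (tensorLeft K (S x)) (T y) (T' y)

lemma opTensor_smul_left (c : ℂ) (S : H →L[ℂ] H) (T : K →L[ℂ] K) :
    opTensor (c • S) T = c • opTensor S T := by
  refine HilbertTensor.ext fun x y => ?_
  rw [smul_apply]
  simp only [opTensor_vecTensor]
  exact map_smul (tensorRight H (T y)) c (S x)

lemma opTensor_smul_right (c : ℂ) (S : H →L[ℂ] H) (T : K →L[ℂ] K) :
    opTensor S (c • T) = c • opTensor S T := by
  refine HilbertTensor.ext fun x y => ?_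
  rw [smul_apply]
  simp only [opTensor_vecTensor]
  exact map_smul (tensorLeft K (S x)) c (T y)

lemma opTensor_mul (S S' : H →L[ℂ] H) (T T' : K →L[ℂ] K) :
    opTensor S T * opTensor S' T' = opTensor (S * S') (T * T') := by
  refine HilbertTensor.ext fun x y => ?_
  simp [opTensor_vecTensor]

lemma star_opTensor [CompleteSpace H] [CompleteSpace K] (S : H →L[ℂ] H) (T : K →L[ℂ] K) :
    star (opTensor S T) = opTensor (star S) (star T) := by
  refine HilbertTensor.op_ext fun x y x' y' => ?_
  simp [ContinuousLinearMap.star_eq_adjoint, ContinuousLinearMap.adjoint_inner_right,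
    opTensor_vecTensor, inner_vecTensor]

lemma norm_tensorRight_le (y : K) : ‖tensorRight H y‖ ≤ ‖y‖ :=
  ContinuousLinearMap.opNorm_le_bound _ (norm_nonneg _) fun x => by
    rw [tensorRight_apply, norm_vecTensor, mul_comm]

lemma norm_tensorLeft_le (x : H) : ‖tensorLeft K x‖ ≤ ‖x‖ :=
  ContinuousLinearMap.opNorm_le_bound _ (norm_nonneg _) fun y => by
    rw [tensorLeft_apply, norm_vecTensor]

end HilbertSpaces

/-! ### Compressions of operators -/

/-- The map `T ↦ W^* T V`. -/
def compress {H K : Type u} [NormedAddCommGroup H] [InnerProductSpace ℂ H] [CompleteSpace H]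
    [NormedAddCommGroup K] [InnerProductSpace ℂ K] [CompleteSpace K] (V W : H →L[ℂ] K) :
    (K →L[ℂ] K) →L[ℂ] (H →L[ℂ] H) :=
  LinearMap.mkContinuous
    { toFun := fun T => ContinuousLinearMap.adjoint W ∘L T ∘L V
      map_add' := fun S T => by ext; simp
      map_smul' := fun c T => by ext; simp } (‖W‖ * ‖V‖) fun T => by
    calc ‖ContinuousLinearMap.adjoint W ∘L T ∘L V‖ ≤
          ‖ContinuousLinearMap.adjoint W‖ * (‖T‖ * ‖V‖) :=
        (ContinuousLinearMap.opNorm_comp_le _ _).trans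
          (mul_le_mul_of_nonneg_left (ContinuousLinearMap.opNorm_comp_le _ _) (norm_nonneg _))
      _ = ‖W‖ * ‖V‖ * ‖T‖ := by rw [LinearIsometryEquiv.norm_map]; ring

section Compress

variable {H K : Type u} [NormedAddCommGroup H] [InnerProductSpace ℂ H] [CompleteSpace H]
  [NormedAddCommGroup K] [InnerProductSpace ℂ K] [CompleteSpace K]

lemma inner_compress (V W : H →L[ℂ] K) (T : K →L[ℂ] K) (x y : H) :
    inner ℂ y (compress V W T x) = inner ℂ (W y) (T (V x)) :=
  ContinuousLinearMap.adjoint_inner_right W y (T (V x))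

lemma norm_compress_le (V W : H →L[ℂ] K) (T : K →L[ℂ] K) :
    ‖compress V W T‖ ≤ ‖W‖ * ‖V‖ * ‖T‖ :=
  ((compress V W).le_opNorm T).trans
    (mul_le_mul_of_nonneg_right (LinearMap.mkContinuous_norm_le _ (by positivity) _)
      (norm_nonneg T))

end Compress

/-- The spatial form of a slice map: for `S = ξ(a)` the result is again in the image of `ξ`, which
is what makes slices take values in the algebra. -/
lemma compress_right_opTensor {H K : Type u} [NormedAddCommGroup H] [InnerProductSpace ℂ H]
    [CompleteSpace H] [NormedAddCommGroup K] [InnerProductSpace ℂ K] (S : H →L[ℂ] H) (T : K →L[ℂ] K) (y y' : K) :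
    compress (tensorRight H y) (tensorRight H y') (opTensor S T) = inner ℂ y' (T y) • S := by
  ext x
  refine ext_inner_left ℂ fun z => ?_
  simp [inner_compress, tensorRight_apply, opTensor_vecTensor, inner_vecTensor, inner_smul_right,
    mul_comm]

lemma compress_left_opTensor {H K : Type u} [NormedAddCommGroup H] [InnerProductSpace ℂ H]
    [NormedAddCommGroup K] [InnerProductSpace ℂ K] [CompleteSpace K] (S : H →L[ℂ] H) (T : K →L[ℂ] K) (x x' : H) :
    compress (tensorLeft K x) (tensorLeft K x') (opTensor S T) = inner ℂ x' (S x) • T := by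
  ext y
  refine ext_inner_left ℂ fun z => ?_
  simp [inner_compress, tensorLeft_apply, opTensor_vecTensor, inner_vecTensor, inner_smul_right]

/-! ### Elementary tensors in the minimal tensor product -/

section MinTensor

variable {A B : Type u} [NonUnitalCStarAlgebra A] [NonUnitalCStarAlgebra B]

/-- The inclusion of the minimal tensor product into the bounded families of operators. -/
def MinTensor.toProduct (A B : Type u) [NonUnitalCStarAlgebra A] [NonUnitalCStarAlgebra B] :
    MinTensor A B →⋆ₙₐ[ℂ] RepProduct A B :=
  (NonUnitalStarSubalgebraClass.subtype
    (cstarGen (Set.range fun p : A × B => elemTensor p.1 p.2))).comp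
    (shrinkHom (cstarGen (Set.range fun p : A × B => elemTensor p.1 p.2)))

lemma MinTensor.toProduct_isometry : Isometry (MinTensor.toProduct A B) :=
  isometry_subtype_coe.comp
    (shrink_isometry (cstarGen (Set.range fun p : A × B => elemTensor p.1 p.2)))

lemma MinTensor.toProduct_tmin (a : A) (b : B) :
    MinTensor.toProduct A B (tmin a b) = elemTensor a b := by
  change (((equivShrink _).symm (equivShrink _ _)) : cstarGen _).1 = _
  rw [Equiv.symm_apply_apply]

/-- The elementary tensors generate the minimal tensor product. -/
lemma MinTensor.generated :
    cstarGen (Set.range fun p : A × B => (tmin p.1 p.2 : MinTensor A B)) = ⊤ := by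
  refine cstarGen_eq_top_of_isometry (MinTensor.toProduct A B) MinTensor.toProduct_isometry _ ?_
  intro x
  rw [← Set.range_comp]
  simp only [Function.comp_def, MinTensor.toProduct_tmin]
  exact ((equivShrink (cstarGen (Set.range fun p : A × B => elemTensor p.1 p.2))).symm x).2

/-- The tensor product of two representations. -/
def Rep.tensor (r : Rep A) (s : Rep B) : Rep (MinTensor A B) where
  H := HilbertTensor r.H s.H
  ξ := (lpEval (D := fun r : RepPair A B => r.Op) ⟨r.H, s.H, r.ξ, s.ξ⟩).comp
    (MinTensor.toProduct A B)

@[simp] lemma Rep.tensor_tmin (r : Rep A) (s : Rep B) (a : A) (b : B) :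
    (r.tensor s).ξ (tmin a b) = opTensor (r.ξ a) (s.ξ b) := by
  change (MinTensor.toProduct A B (tmin a b)) ⟨r.H, s.H, r.ξ, s.ξ⟩ = _
  rw [MinTensor.toProduct_tmin]
  rfl

lemma MinTensor.eq_zero {x : MinTensor A B}
    (h : ∀ (r : Rep A) (s : Rep B), (r.tensor s).ξ x = 0) : x = 0 := by
  refine MinTensor.toProduct_isometry.injective ?_
  rw [map_zero]
  ext r : 2
  exact h ⟨r.H₁, r.ξ₁⟩ ⟨r.H₂, r.ξ₂⟩

lemma MinTensor.ext {x y : MinTensor A B}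
    (h : ∀ (r : Rep A) (s : Rep B), (r.tensor s).ξ x = (r.tensor s).ξ y) : x = y := by
  rw [← sub_eq_zero]
  exact MinTensor.eq_zero fun r s => by rw [map_sub, h, sub_self]

lemma tmin_add_left (a a' : A) (b : B) : tmin (a + a') b = tmin a b + tmin a' b :=
  MinTensor.ext fun r s => by
    rw [map_add]; simp only [Rep.tensor_tmin]; rw [map_add]; exact opTensor_add_left _ _ _

lemma tmin_add_right (a : A) (b b' : B) : tmin a (b + b') = tmin a b + tmin a b' :=
  MinTensor.ext fun r s => by
    rw [map_add]; simp only [Rep.tensor_tmin]; rw [map_add]; exact opTensor_add_right _ _ _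

lemma tmin_smul_left (c : ℂ) (a : A) (b : B) : tmin (c • a) b = c • tmin a b :=
  MinTensor.ext fun r s => by
    rw [map_smul]; simp only [Rep.tensor_tmin]; rw [map_smul]; exact opTensor_smul_left _ _ _

lemma tmin_smul_right (c : ℂ) (a : A) (b : B) : tmin a (c • b) = c • tmin a b :=
  MinTensor.ext fun r s => by
    rw [map_smul]; simp only [Rep.tensor_tmin]; rw [map_smul]; exact opTensor_smul_right _ _ _

lemma tmin_mul (a a' : A) (b b' : B) : tmin (a * a') (b * b') = tmin a b * tmin a' b' :=
  MinTensor.ext fun r s => by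
    rw [map_mul]; simp only [Rep.tensor_tmin]; rw [map_mul, map_mul]
    exact (opTensor_mul _ _ _ _).symm

lemma star_tmin (a : A) (b : B) : star (tmin a b) = tmin (star a) (star b) :=
  MinTensor.ext fun r s => by
    rw [map_star]; simp only [Rep.tensor_tmin]; rw [map_star, map_star]
    exact star_opTensor _ _

/-- The map `(a, b) ↦ a ⊗ b` as a bilinear map. -/
def tminₗ (A B : Type u) [NonUnitalCStarAlgebra A] [NonUnitalCStarAlgebra B] :
    A →ₗ[ℂ] B →ₗ[ℂ] MinTensor A B :=
  LinearMap.mk₂ ℂ tmin tmin_add_left tmin_smul_left tmin_add_right tmin_smul_right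

lemma tminₗ_apply (a : A) (b : B) : tminₗ A B a b = tmin a b := rfl

lemma tmin_sum_left {ι : Type*} (s : Finset ι) (f : ι → A) (b : B) :
    tmin (∑ i ∈ s, f i) b = ∑ i ∈ s, tmin (f i) b := by
  simp only [← tminₗ_apply, map_sum, LinearMap.sum_apply]

lemma tmin_sum_right {ι : Type*} (s : Finset ι) (a : A) (f : ι → B) :
    tmin a (∑ i ∈ s, f i) = ∑ i ∈ s, tmin a (f i) := by
  simp only [← tminₗ_apply, map_sum]

lemma norm_tmin_le (a : A) (b : B) : ‖tmin a b‖ ≤ ‖a‖ * ‖b‖ := by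
  have h := MinTensor.toProduct_isometry.norm_map_of_map_zero (map_zero _) (tmin a b)
  rw [← h, MinTensor.toProduct_tmin]
  exact lp.norm_le_of_forall_le (by positivity) fun r => (norm_opTensor_le _ _).trans
    (mul_le_mul (NonUnitalStarAlgHom.norm_apply_le r.ξ₁ a)
      (NonUnitalStarAlgHom.norm_apply_le r.ξ₂ b) (norm_nonneg _) (norm_nonneg _))

lemma continuous_tmin_left (b : B) : Continuous fun a : A => tmin a b :=
  AddMonoidHomClass.continuous_of_bound ((tminₗ A B).flip b) ‖b‖ fun a =>
    (norm_tmin_le a b).trans_eq (mul_comm _ _)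

/-- Products and adjoints of elementary tensors are elementary tensors, so their span is already a
`*`-algebra. -/
lemma MinTensor.span_eq_adjoin :
    Submodule.span ℂ (Set.range fun p : A × B => (tmin p.1 p.2 : MinTensor A B)) =
      (NonUnitalStarAlgebra.adjoin ℂ
        (Set.range fun p : A × B => (tmin p.1 p.2 : MinTensor A B))).toSubmodule := by
  rw [NonUnitalStarAlgebra.adjoin_eq_span]
  congr 1
  refine Set.Subset.antisymm (fun x hx => Subsemigroup.subset_closure (Or.inl hx)) ?_
  have : Subsemigroup.closure ((Set.range fun p : A × B => (tmin p.1 p.2 : MinTensor A B)) ∪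
      star (Set.range fun p : A × B => (tmin p.1 p.2 : MinTensor A B))) ≤
      { carrier := Set.range fun p : A × B => (tmin p.1 p.2 : MinTensor A B)
        mul_mem' := by
          rintro _ _ ⟨p, rfl⟩ ⟨q, rfl⟩
          exact ⟨(p.1 * q.1, p.2 * q.2), tmin_mul _ _ _ _⟩ } := by
    rw [Subsemigroup.closure_le]
    rintro x (hx | ⟨p, hp⟩)
    · exact hx
    · exact ⟨(star p.1, star p.2), by simp only [← star_tmin] at hp ⊢; rw [hp, star_star]⟩
  exact this

/-- The elementary tensors span a dense subspace of the minimal tensor product. -/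
lemma MinTensor.induction {P : MinTensor A B → Prop} (hP : IsClosed {x | P x})
    (tmul : ∀ a b, P (tmin a b)) (add : ∀ x y, P x → P y → P (x + y)) (x : MinTensor A B) : P x := by
  have hx : x ∈ cstarGen (Set.range fun p : A × B => (tmin p.1 p.2 : MinTensor A B)) := by
    rw [MinTensor.generated]; trivial
  refine closure_minimal (s := (NonUnitalStarAlgebra.adjoin ℂ
    (Set.range fun p : A × B => (tmin p.1 p.2 : MinTensor A B)) : Set (MinTensor A B)))
    (fun y hy => ?_) hP hx
  have hy' : y ∈ (NonUnitalStarAlgebra.adjoin ℂ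
    (Set.range fun p : A × B => (tmin p.1 p.2 : MinTensor A B))).toSubmodule := hy
  rw [← MinTensor.span_eq_adjoin] at hy'
  obtain ⟨n, c, z, hz, rfl⟩ := Submodule.mem_span_set'.1 hy'
  clear hy hy'
  have h0 : P 0 := by
    have h1 : tmin (0 : A) (0 : B) = 0 := map_zero (tminₗ A B 0)
    rw [← h1]
    exact tmul 0 0
  refine Finset.sum_induction _ P add h0 fun i _ => ?_
  obtain ⟨p, hp⟩ := (z i).2
  rw [← hp, ← tmin_smul_left]
  exact tmul _ _

end MinTensor

/-! ### Slice maps -/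

lemma Rep.eq_of_eq {A : Type u} [NonUnitalCStarAlgebra A] {x y : A}
    (h : ∀ r : Rep A, r.ξ x = r.ξ y) : x = y := by
  rw [← sub_eq_zero]
  exact Rep.ext fun r => by rw [map_sub, h, sub_self]

/-- All representations together form an injective, hence isometric, `*`-homomorphism. -/
lemma Rep.norm_le {A : Type u} [NonUnitalCStarAlgebra A] {x : A} {C : ℝ} (hC : 0 ≤ C)
    (h : ∀ r : Rep A, ‖r.ξ x‖ ≤ C) : ‖x‖ ≤ C := by
  rw [← NonUnitalStarAlgHom.norm_map (lpHom fun r : Rep A => r.ξ)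
    (lpHom_injective _ fun x hx => Rep.ext hx) x]
  exact lp.norm_le_of_forall_le hC h

/-- A bounded family of linear maps `c r : A ⊗ B → B(H_r)` that takes values in the image of `D`
on elementary tensors is induced by a bounded linear map `A ⊗ B → D`. -/
theorem exists_slice {A B D : Type u} [NonUnitalCStarAlgebra A] [NonUnitalCStarAlgebra B]
    [NonUnitalCStarAlgebra D] (c : ∀ r : Rep D, MinTensor A B →L[ℂ] (r.H →L[ℂ] r.H)) (C : ℝ)
    (hC : ∀ r x, ‖c r x‖ ≤ C * ‖x‖) (h : ∀ a b, ∃ d, ∀ r : Rep D, r.ξ d = c r (tmin a b)) :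
    ∃ R : MinTensor A B →L[ℂ] D, ∀ r x, r.ξ (R x) = c r x := by
  -- The sign of `C` is not known, whereas operator bounds have to be nonnegative.
  have hC' : ∀ r x, ‖c r x‖ ≤ max C 0 * ‖x‖ := fun r x =>
    (hC r x).trans (mul_le_mul_of_nonneg_right (le_max_left _ _) (norm_nonneg _))
  have hmem : ∀ x, ∃ d, ∀ r : Rep D, r.ξ d = c r x := by
    let Tl : MinTensor A B →ₗ[ℂ] lp (fun r : Rep D => r.H →L[ℂ] r.H) ∞ :=
      { toFun := fun x => ⟨fun r => c r x, memℓp_infty ⟨max C 0 * ‖x‖, by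
          rintro _ ⟨r, rfl⟩
          exact hC' r x⟩⟩
        map_add' := fun x y => by ext r : 2; exact map_add (c r) x y
        map_smul' := fun k x => by ext r : 2; exact map_smul (c r) k x }
    let T := Tl.mkContinuous (max C 0) fun x =>
      lp.norm_le_of_forall_le (mul_nonneg (le_max_right _ _) (norm_nonneg _)) fun r => hC' r x
    let U := lpHom fun r : Rep D => r.ξ
    have hU : Function.Injective U := lpHom_injective _ fun x hx => Rep.ext hx
    -- The range of `U` is closed, so membership passes from elementary tensors to sums and limits.
    have key : ∀ x, T x ∈ Set.range U := by
      intro x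
      induction x using MinTensor.induction with
      | hP => exact (isClosed_range_of_injective U hU).preimage T.continuous
      | tmul a b =>
        obtain ⟨d, hd⟩ := h a b
        exact ⟨d, by ext r : 2; exact hd r⟩
      | add x y hx hy =>
        obtain ⟨d, hd⟩ := hx
        obtain ⟨e, he⟩ := hy
        exact ⟨d + e, by rw [map_add, map_add, hd, he]⟩
    intro x
    obtain ⟨d, hd⟩ := key x
    exact ⟨d, fun r => congrArg (fun z => lpEval (D := fun r : Rep D => r.H →L[ℂ] r.H) r z) hd⟩
  choose R hR using hmem
  refine ⟨LinearMap.mkContinuous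
    { toFun := R
      map_add' := fun x y => Rep.eq_of_eq fun r => by simp [hR]
      map_smul' := fun k x => Rep.eq_of_eq fun r => by simp [hR] } (max C 0) fun x => ?_,
    fun r x => hR x r⟩
  refine Rep.norm_le (mul_nonneg (le_max_right _ _) (norm_nonneg _)) fun r => ?_
  change ‖r.ξ (R x)‖ ≤ _
  rw [hR]
  exact hC' r x

section Slices

variable {A B : Type u} [NonUnitalCStarAlgebra A] [NonUnitalCStarAlgebra B]

lemma Rep.norm_ξ_le (r : Rep A) (a : A) : ‖r.ξ a‖ ≤ ‖a‖ := NonUnitalStarAlgHom.norm_apply_le r.ξ a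

/-- A representation as a bounded linear map. -/
def Rep.toCLM (r : Rep A) : A →L[ℂ] (r.H →L[ℂ] r.H) :=
  LinearMap.mkContinuous
    { toFun := r.ξ, map_add' := map_add r.ξ, map_smul' := map_smul r.ξ } 1 fun x => by
      simpa using r.norm_ξ_le x

/-- The slice map `id ⊗ ⟪w, s(·) v⟫`. -/
theorem exists_slice_right (A : Type u) [NonUnitalCStarAlgebra A] (s : Rep B) (v w : s.H) :
    ∃ R : MinTensor A B →L[ℂ] A, (∀ a b, R (tmin a b) = inner ℂ w (s.ξ b v) • a) ∧
      ∀ (r : Rep A) x p q,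
        inner ℂ q (r.ξ (R x) p) = inner ℂ (vecTensor q w) ((r.tensor s).ξ x (vecTensor p v)) := by
  have ht : ∀ (r : Rep A) a b, compress (tensorRight r.H v) (tensorRight r.H w)
      ((r.tensor s).ξ (tmin a b)) = r.ξ (inner ℂ w (s.ξ b v) • a) := by
    intro r a b
    rw [Rep.tensor_tmin, map_smul]
    exact compress_right_opTensor _ _ _ _
  obtain ⟨R, hR⟩ := exists_slice (D := A)
    (fun r => (compress (tensorRight r.H v) (tensorRight r.H w)).comp (r.tensor s).toCLM)
    (‖w‖ * ‖v‖) (fun r x => (norm_compress_le _ _ _).trans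
      (mul_le_mul (mul_le_mul (norm_tensorRight_le w) (norm_tensorRight_le v) (norm_nonneg _)
        (norm_nonneg _)) ((r.tensor s).norm_ξ_le x) (norm_nonneg _) (by positivity)))
    (fun a b => ⟨_, fun r => (ht r a b).symm⟩)
  refine ⟨R, fun a b => Rep.eq_of_eq fun r => (hR r _).trans (ht r a b), fun r x p q => ?_⟩
  rw [hR]
  exact inner_compress (tensorRight r.H v) (tensorRight r.H w) _ p q

/-- The slice map `⟪q, r(·) p⟫ ⊗ id`. -/
theorem exists_slice_left (B : Type u) [NonUnitalCStarAlgebra B] (r : Rep A) (p q : r.H) :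
    ∃ L : MinTensor A B →L[ℂ] B, ∀ (s : Rep B) x v w,
        inner ℂ w (s.ξ (L x) v) = inner ℂ (vecTensor q w) ((r.tensor s).ξ x (vecTensor p v)) := by
  have ht : ∀ (s : Rep B) a b, compress (tensorLeft s.H p) (tensorLeft s.H q)
      ((r.tensor s).ξ (tmin a b)) = s.ξ (inner ℂ q (r.ξ a p) • b) := by
    intro s a b
    rw [Rep.tensor_tmin, map_smul]
    exact compress_left_opTensor _ _ _ _
  obtain ⟨L, hL⟩ := exists_slice (D := B)
    (fun s => (compress (tensorLeft s.H p) (tensorLeft s.H q)).comp (r.tensor s).toCLM)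
    (‖q‖ * ‖p‖) (fun s x => (norm_compress_le _ _ _).trans
      (mul_le_mul (mul_le_mul (norm_tensorLeft_le q) (norm_tensorLeft_le p) (norm_nonneg _)
        (norm_nonneg _)) ((r.tensor s).norm_ξ_le x) (norm_nonneg _) (by positivity)))
    (fun a b => ⟨_, fun s => (ht s a b).symm⟩)
  refine ⟨L, fun s x v w => ?_⟩
  rw [hL]
  exact inner_compress (tensorLeft s.H p) (tensorLeft s.H q) _ v w

lemma Rep.eq_zero_of_inner {r : Rep A} {a : A} (h : ∀ p q, inner ℂ q (r.ξ a p) = (0 : ℂ)) :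
    r.ξ a = 0 := by
  ext p
  exact ext_inner_left ℂ fun q => by rw [h]; simp

lemma Rep.tensor_eq_zero_of_inner {r : Rep A} {s : Rep B} {x : MinTensor A B}
    (h : ∀ p v q w, inner ℂ (vecTensor q w) ((r.tensor s).ξ x (vecTensor p v)) = (0 : ℂ)) :
    (r.tensor s).ξ x = 0 :=
  HilbertTensor.op_ext (H := r.H) (K := s.H) fun p v q w => (h p v q w).trans
    (inner_zero_right _).symm

/-- Jointly injective families of representations of `A` and of `B` give a jointly injective family
of representations of `A ⊗ B`. -/
theorem MinTensor.eq_zero_of_separating {ι κ : Type*} (r : ι → Rep A)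
    (hr : ∀ a, (∀ i, (r i).ξ a = 0) → a = 0) (s : κ → Rep B)
    (hs : ∀ b, (∀ j, (s j).ξ b = 0) → b = 0) (x : MinTensor A B)
    (hx : ∀ i j, ((r i).tensor (s j)).ξ x = 0) : x = 0 := by
  -- Slicing off the second leg gives an element of `A` killed by every `r i`, hence zero. So `r i`
  -- may be replaced by an arbitrary representation; afterwards the same is done with the other leg.
  have h1 : ∀ (r' : Rep A) j, (r'.tensor (s j)).ξ x = 0 := by
    intro r' j
    refine Rep.tensor_eq_zero_of_inner fun p v q w => ?_
    obtain ⟨R, -, hR⟩ := exists_slice_right A (s j) v w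
    have hRx : R x = 0 := hr _ fun i => Rep.eq_zero_of_inner fun p q => by
      rw [hR, hx]; exact inner_zero_right _
    rw [← hR, hRx, map_zero]; exact inner_zero_right _
  refine MinTensor.eq_zero fun r' s' => Rep.tensor_eq_zero_of_inner fun p v q w => ?_
  obtain ⟨L, hL⟩ := exists_slice_left B r' p q
  have hLx : L x = 0 := hs _ fun j => Rep.eq_zero_of_inner fun v w => by
    rw [hL, h1]; exact inner_zero_right _
  rw [← hL, hLx, map_zero]; exact inner_zero_right _

end Slices

/-! ### `*`-homomorphisms of minimal tensor products -/

/-- The tensor product `f ⊗ g` of `*`-homomorphisms. -/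
theorem MinTensor.exists_map {A B A' B' : Type u} [NonUnitalCStarAlgebra A]
    [NonUnitalCStarAlgebra B] [NonUnitalCStarAlgebra A'] [NonUnitalCStarAlgebra B']
    (f : A →⋆ₙₐ[ℂ] A') (g : B →⋆ₙₐ[ℂ] B') :
    ∃ θ : MinTensor A B →⋆ₙₐ[ℂ] MinTensor A' B', ∀ a b, θ (tmin a b) = tmin (f a) (g b) := by
  let Φ : ∀ i : Rep A' × Rep B', MinTensor A' B' →⋆ₙₐ[ℂ] _ := fun i => (i.1.tensor i.2).ξ
  -- Pulling back does not change the Hilbert space, so `Φ i` and `Ψ i` have the same target.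
  let Ψ : ∀ i : Rep A' × Rep B', MinTensor A B →⋆ₙₐ[ℂ]
      ((i.1.tensor i.2).H →L[ℂ] (i.1.tensor i.2).H) :=
    fun i => ((i.1.comap f).tensor (i.2.comap g)).ξ
  have hΦΨ : ∀ i a b, Φ i (tmin (f a) (g b)) = Ψ i (tmin a b) := fun i a b =>
    (Rep.tensor_tmin i.1 i.2 (f a) (g b)).trans
      (Rep.tensor_tmin (i.1.comap f) (i.2.comap g) a b).symm
  obtain ⟨θ, hθ⟩ := exists_lift Φ (fun x hx => MinTensor.eq_zero fun r s => hx (r, s)) Ψ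
    MinTensor.generated (by
      rintro _ ⟨⟨a, b⟩, rfl⟩
      exact ⟨tmin (f a) (g b), fun i => hΦΨ i a b⟩)
  exact ⟨θ, fun a b => hθ _ _ fun i => hΦΨ i a b⟩

/-- The one-dimensional representation given by a `*`-homomorphism to `ℂ`. -/
def Rep.ofCharacter {A : Type u} [NonUnitalCStarAlgebra A] (ν : A →⋆ₙₐ[ℂ] ℂ) : Rep A where
  -- A one-dimensional Hilbert space in universe `u`; `ℂ` itself lies in universe `0`.
  H := EuclideanSpace ℂ PUnit.{u + 1}
  ξ :=
    { toFun := fun a => ν a • 1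
      map_smul' := fun c a => by simp [mul_smul]
      map_zero' := by simp
      map_add' := fun a b => by simp [add_smul]
      map_mul' := fun a b => by rw [map_mul, smul_mul_smul_comm, mul_one]
      map_star' := fun a => by simp [map_star] }

/-- The `*`-homomorphism `id ⊗ ν : A ⊗ B → A`, for a `*`-homomorphism `ν : B → ℂ`. -/
theorem MinTensor.exists_id_tensor {A B : Type u} [NonUnitalCStarAlgebra A]
    [NonUnitalCStarAlgebra B] (ν : B →⋆ₙₐ[ℂ] ℂ) :
    ∃ θ : MinTensor A B →⋆ₙₐ[ℂ] A, ∀ a b, θ (tmin a b) = ν b • a := by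
  let e : (Rep.ofCharacter ν).H := EuclideanSpace.single PUnit.unit 1
  obtain ⟨R, hR, -⟩ := exists_slice_right A (Rep.ofCharacter ν) e e
  have he : ∀ b, inner ℂ e ((Rep.ofCharacter ν).ξ b e) = ν b := by
    intro b
    change inner ℂ e (ν b • e) = ν b
    rw [inner_smul_right, inner_self_eq_norm_sq_to_K]
    have : ‖e‖ = 1 := by
      have h : ‖(EuclideanSpace.single PUnit.unit 1 : EuclideanSpace ℂ PUnit.{u + 1})‖ = 1 := by
        rw [PiLp.norm_single, norm_one]
      exact h
    rw [this]; simp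
  simp only [he] at hR
  -- A slice map is only linear in general; it is multiplicative here because `ν` is.
  have hmul : ∀ x y, R (x * y) = R x * R y := by
    intro x y
    induction x using MinTensor.induction with
    | hP => exact isClosed_eq (by fun_prop) (by fun_prop)
    | add x x' hx hx' => rw [add_mul, map_add, map_add, hx, hx', add_mul]
    | tmul a b =>
      induction y using MinTensor.induction with
      | hP => exact isClosed_eq (by fun_prop) (by fun_prop)
      | add y y' hy hy' => rw [mul_add, map_add, map_add, hy, hy', mul_add]
      | tmul a' b' =>
        rw [← tmin_mul, hR, hR, hR, map_mul, smul_mul_smul_comm]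
  have hstar : ∀ x, R (star x) = star (R x) := by
    intro x
    induction x using MinTensor.induction with
    | hP => exact isClosed_eq (by fun_prop) (by fun_prop)
    | add x x' hx hx' => rw [star_add, map_add, map_add, hx, hx', star_add]
    | tmul a b => rw [star_tmin, hR, hR, map_star, star_smul]
  exact ⟨{ toFun := R
           map_smul' := fun c x => map_smul R c x
           map_zero' := map_zero R
           map_add' := fun x y => map_add R x y
           map_mul' := hmul
           map_star' := hstar }, hR⟩

/-! ### Associativity -/

section Associator

variable (H K L : Type u) [NormedAddCommGroup H] [InnerProductSpace ℂ H]
  [NormedAddCommGroup K] [InnerProductSpace ℂ K] [NormedAddCommGroup L] [InnerProductSpace ℂ L]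

/-- The embedding of the algebraic tensor product `(H ⊗ K) ⊗ L`. -/
def embedLeft : (H ⊗[ℂ] K) ⊗[ℂ] L →ₗᵢ[ℂ] HilbertTensor (HilbertTensor H K) L :=
  UniformSpace.Completion.toComplₗᵢ.comp (UniformSpace.Completion.toComplₗᵢ.rTensor L)

/-- The embedding of the algebraic tensor product `H ⊗ (K ⊗ L)`. -/
def embedRight : H ⊗[ℂ] (K ⊗[ℂ] L) →ₗᵢ[ℂ] HilbertTensor H (HilbertTensor K L) :=
  UniformSpace.Completion.toComplₗᵢ.comp (UniformSpace.Completion.toComplₗᵢ.lTensor H)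

variable {H K L}

lemma embedLeft_tmul (x : H) (y : K) (z : L) :
    embedLeft H K L ((x ⊗ₜ y) ⊗ₜ z) = vecTensor (vecTensor x y) z := by
  simp [embedLeft, vecTensor]

lemma embedRight_tmul (x : H) (y : K) (z : L) :
    embedRight H K L (x ⊗ₜ (y ⊗ₜ z)) = vecTensor x (vecTensor y z) := by
  simp [embedRight, vecTensor]

/-- A closed subspace that contains all `x ⊗ y` is everything. -/
lemma HilbertTensor.mem_of_vecTensor_mem (W : Submodule ℂ (HilbertTensor H K))
    (hW : IsClosed (W : Set (HilbertTensor H K))) (h : ∀ x y, vecTensor x y ∈ W)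
    (z : HilbertTensor H K) : z ∈ W := by
  induction z using UniformSpace.Completion.induction_on with
  | hp => exact hW
  | ih z =>
    induction z using TensorProduct.induction_on with
    | zero => rw [UniformSpace.Completion.coe_zero]; exact W.zero_mem
    | tmul x y => exact h x y
    | add z w hz hw => rw [UniformSpace.Completion.coe_add]; exact W.add_mem hz hw

lemma denseRange_embedLeft : DenseRange (embedLeft H K L) := by
  let W := (LinearMap.range (embedLeft H K L).toLinearMap).topologicalClosure
  have hW : IsClosed (W : Set (HilbertTensor (HilbertTensor H K) L)) :=
    Submodule.isClosed_topologicalClosure _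
  intro z
  refine HilbertTensor.mem_of_vecTensor_mem W hW (fun x z => ?_) z
  -- With `z` fixed, the vectors `x` such that `x ⊗ z` lies in `W` form a closed subspace, so it is
  -- enough to treat `x = x' ⊗ y`.
  refine HilbertTensor.mem_of_vecTensor_mem (W.comap (tensorRight _ z).toLinearMap)
    (hW.preimage (tensorRight _ z).continuous) (fun x y => ?_) x
  exact Submodule.le_topologicalClosure _ ⟨(x ⊗ₜ y) ⊗ₜ z, embedLeft_tmul x y z⟩

lemma denseRange_embedRight : DenseRange (embedRight H K L) := by
  let W := (LinearMap.range (embedRight H K L).toLinearMap).topologicalClosure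
  have hW : IsClosed (W : Set (HilbertTensor H (HilbertTensor K L))) :=
    Submodule.isClosed_topologicalClosure _
  intro z
  refine HilbertTensor.mem_of_vecTensor_mem W hW (fun x z => ?_) z
  refine HilbertTensor.mem_of_vecTensor_mem (W.comap (tensorLeft _ x).toLinearMap)
    (hW.preimage (tensorLeft _ x).continuous) (fun y z => ?_) z
  exact Submodule.le_topologicalClosure _ ⟨x ⊗ₜ (y ⊗ₜ z), embedRight_tmul x y z⟩

variable (H K L) in
/-- The associator of Hilbert space tensor products. -/
def hilbertAssoc :
    HilbertTensor (HilbertTensor H K) L ≃ₗᵢ[ℂ] HilbertTensor H (HilbertTensor K L) :=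
  (TensorProduct.assoc ℂ H K L).extendOfIsometry (embedLeft H K L).toLinearMap
    (embedRight H K L).toLinearMap denseRange_embedLeft denseRange_embedRight fun x => by
      change ‖embedRight H K L _‖ = ‖embedLeft H K L x‖
      rw [LinearIsometry.norm_map, LinearIsometry.norm_map, TensorProduct.norm_assoc]

lemma hilbertAssoc_vecTensor (x : H) (y : K) (z : L) :
    hilbertAssoc H K L (vecTensor (vecTensor x y) z) = vecTensor x (vecTensor y z) := by
  rw [← embedLeft_tmul, ← embedRight_tmul]
  exact LinearEquiv.extendOfIsometry_eq _ _ _ _ _ _ _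

lemma hilbertAssoc_conj [CompleteSpace H] [CompleteSpace K] [CompleteSpace L]
    (S : H →L[ℂ] H) (T : K →L[ℂ] K) (U : L →L[ℂ] L) :
    (hilbertAssoc H K L).conjStarAlgEquiv (opTensor (opTensor S T) U) =
      opTensor S (opTensor T U) := by
  rw [LinearIsometryEquiv.conjStarAlgEquiv_apply]
  have h : ∀ x y z, (hilbertAssoc H K L).symm (vecTensor x (vecTensor y z)) =
      vecTensor (vecTensor x y) z := fun x y z => by
    rw [← hilbertAssoc_vecTensor, LinearIsometryEquiv.symm_apply_apply]
  refine HilbertTensor.ext fun x v => ?_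
  -- With `x` fixed, both sides are operators in `v`, and vectors `v = y ⊗ z` suffice.
  refine congrArg (fun f : HilbertTensor K L →L[ℂ] _ => f v) (?_ :
    (hilbertAssoc H K L ∘L opTensor (opTensor S T) U ∘L (hilbertAssoc H K L).symm) ∘L
      tensorLeft _ x = opTensor S (opTensor T U) ∘L tensorLeft _ x)
  refine HilbertTensor.ext fun y z => ?_
  simp [tensorLeft_apply, h, opTensor_vecTensor, hilbertAssoc_vecTensor]

end Associator

lemma MinTensor.generated_triple (A B C : Type u) [NonUnitalCStarAlgebra A]
    [NonUnitalCStarAlgebra B] [NonUnitalCStarAlgebra C] :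
    cstarGen (Set.range fun p : A × B × C => tmin (tmin p.1 p.2.1) p.2.2) = ⊤ := by
  have h : ∀ x, x ∈ cstarGen (Set.range fun p : A × B × C => tmin (tmin p.1 p.2.1) p.2.2) := by
    intro x
    induction x using MinTensor.induction with
    | hP => exact isClosed_cstarGen _
    | add x y hx hy => exact add_mem hx hy
    | tmul x c =>
      induction x using MinTensor.induction with
      | hP => exact (isClosed_cstarGen _).preimage (continuous_tmin_left c)
      | add x y hx hy => rw [tmin_add_left]; exact add_mem hx hy
      | tmul a b => exact subset_cstarGen _ ⟨(a, b, c), rfl⟩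
  rw [eq_top_iff]
  exact fun x _ => h x

/-- The associator `(A ⊗ B) ⊗ C → A ⊗ (B ⊗ C)` of minimal tensor products. -/
theorem MinTensor.exists_assoc (A B C : Type u) [NonUnitalCStarAlgebra A]
    [NonUnitalCStarAlgebra B] [NonUnitalCStarAlgebra C] :
    ∃ θ : MinTensor (MinTensor A B) C →⋆ₙₐ[ℂ] MinTensor A (MinTensor B C),
      ∀ a b c, θ (tmin (tmin a b) c) = tmin a (tmin b c) := by
  let Φ : ∀ i : Rep A × Rep B × Rep C, MinTensor A (MinTensor B C) →⋆ₙₐ[ℂ]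
      ((i.1.tensor (i.2.1.tensor i.2.2)).H →L[ℂ] (i.1.tensor (i.2.1.tensor i.2.2)).H) :=
    fun i => (i.1.tensor (i.2.1.tensor i.2.2)).ξ
  let Ψ : ∀ i : Rep A × Rep B × Rep C, MinTensor (MinTensor A B) C →⋆ₙₐ[ℂ]
      ((i.1.tensor (i.2.1.tensor i.2.2)).H →L[ℂ] (i.1.tensor (i.2.1.tensor i.2.2)).H) :=
    fun i => (StarAlgHom.toNonUnitalStarAlgHom
      (hilbertAssoc i.1.H i.2.1.H i.2.2.H).conjStarAlgEquiv.toStarAlgHom).comp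
      ((i.1.tensor i.2.1).tensor i.2.2).ξ
  -- The representations `s ⊗ t` of `B ⊗ C` do not exhaust all of its representations, but they
  -- separate its points.
  have hΦ : ∀ x, (∀ i, Φ i x = 0) → x = 0 := fun x hx =>
    MinTensor.eq_zero_of_separating (fun r : Rep A => r) (fun _ => Rep.ext)
      (fun i : Rep B × Rep C => i.1.tensor i.2)
      (fun b hb => MinTensor.eq_zero fun r s => hb (r, s)) x fun r i => hx (r, i.1, i.2)
  have hΦΨ : ∀ i a b c, Φ i (tmin a (tmin b c)) = Ψ i (tmin (tmin a b) c) := by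
    intro i a b c
    have h1 : Φ i (tmin a (tmin b c)) =
        opTensor (i.1.ξ a) (opTensor (i.2.1.ξ b) (i.2.2.ξ c)) := by
      rw [← Rep.tensor_tmin]; exact Rep.tensor_tmin _ _ _ _
    have h2 : ((i.1.tensor i.2.1).tensor i.2.2).ξ (tmin (tmin a b) c) =
        opTensor (opTensor (i.1.ξ a) (i.2.1.ξ b)) (i.2.2.ξ c) := by
      rw [← Rep.tensor_tmin]; exact Rep.tensor_tmin _ _ _ _
    rw [h1, ← hilbertAssoc_conj, ← h2]
    rfl
  obtain ⟨θ, hθ⟩ := exists_lift Φ hΦ Ψ (MinTensor.generated_triple A B C) (by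
    rintro _ ⟨⟨a, b, c⟩, rfl⟩
    exact ⟨_, fun i => hΦΨ i a b c⟩)
  exact ⟨θ, fun a b c => hθ _ _ fun i => hΦΨ i a b c⟩

/-! ### Identities of C*-algebras -/

section Identity

variable {A : Type u} {B : Type v} [NonUnitalCStarAlgebra A] [NonUnitalCStarAlgebra B]

lemma IsIdentity.star_eq {e : A} (he : IsIdentity e) : star e = e := by
  have h := congrArg star (he (star e)).1
  rw [star_mul, star_star, (he _).1] at h
  exact h

/-- The image of the identity is an identity if it fixes a generating set. -/
lemma IsIdentity.map_of_generates {s : Set B} (hs : cstarGen s = ⊤) {e : A} (he : IsIdentity e)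
    (f : A →⋆ₙₐ[ℂ] B) (hf : s ⊆ Set.range f) : IsIdentity (f e) := by
  have hstar : star (f e) = f e := by rw [← map_star, he.star_eq]
  -- The elements on which `f e` acts as a two-sided unit; closure under adjoints uses that `f e` is
  -- self-adjoint.
  let K : NonUnitalStarSubalgebra ℂ B :=
    { carrier := {a | f e * a = a ∧ a * f e = a}
      zero_mem' := by simp
      add_mem' := fun {a b} ha hb => by
        simp only [Set.mem_ofPred_eq] at ha hb ⊢
        rw [mul_add, add_mul, ha.1, ha.2, hb.1, hb.2]
        exact ⟨rfl, rfl⟩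
      mul_mem' := fun {a b} ha hb => by
        simp only [Set.mem_ofPred_eq] at ha hb ⊢
        rw [← mul_assoc, ha.1, mul_assoc, hb.2]
        exact ⟨rfl, rfl⟩
      smul_mem' := fun c a ha => by
        simp only [Set.mem_ofPred_eq] at ha ⊢
        rw [mul_smul_comm, smul_mul_assoc, ha.1, ha.2]
        exact ⟨rfl, rfl⟩
      star_mem' := fun {a} ha => by
        simp only [Set.mem_ofPred_eq] at ha ⊢
        refine ⟨?_, ?_⟩
        · nth_rewrite 1 [← hstar]; rw [← star_mul, ha.2]
        · nth_rewrite 1 [← hstar]; rw [← star_mul, ha.1] }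
  have hK : IsClosed (K : Set B) :=
    (isClosed_eq (continuous_const.mul continuous_id) continuous_id).inter
      (isClosed_eq (continuous_id.mul continuous_const) continuous_id)
  refine eq_top_of_generates hs K hK fun x hx => ?_
  obtain ⟨a, rfl⟩ := hf hx
  exact ⟨by rw [← map_mul, (he a).1], by rw [← map_mul, (he a).2]⟩

lemma IsIdentity.map_arrow {N : ℕ} {X : Obj.{u} N} {Y : Obj.{v} N} {e : X.alg} (he : IsIdentity e)
    (f : Arrow X Y) : IsIdentity (f.hom e) := by
  refine he.map_of_generates Y.generated f.hom ?_
  rintro _ ⟨⟨i, j⟩, rfl⟩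
  exact ⟨X.mat i j, f.map_mat i j⟩

lemma IsIdentity.tmin {A B : Type u} [NonUnitalCStarAlgebra A] [NonUnitalCStarAlgebra B] {e : A}
    {e' : B} (he : IsIdentity e) (he' : IsIdentity e') : IsIdentity (tmin e e') := by
  intro x
  induction x using MinTensor.induction with
  | hP =>
    exact (isClosed_eq (continuous_const.mul continuous_id) continuous_id).inter
      (isClosed_eq (continuous_id.mul continuous_const) continuous_id)
  | tmul a b => simp only [← tmin_mul, (he a).1, (he a).2, (he' b).1, (he' b).2, and_self]
  | add x y hx hy => rw [mul_add, add_mul, hx.1, hx.2, hy.1, hy.2]; exact ⟨rfl, rfl⟩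

/-- A C*-algebra with an identity as a unital C*-algebra. -/
abbrev unitalCStarAlgebra (A : Type u) [inst : NonUnitalCStarAlgebra A] (e : A)
    (he : IsIdentity e) : CStarAlgebra A :=
  let ring : NormedRing A :=
    { inst with
      one := e
      one_mul := fun a => (he a).1
      mul_one := fun a => (he a).2 }
  { ring, inst, Algebra.ofModule (R := ℂ) (A := A) smul_mul_assoc mul_smul_comm with }

end Identity

/-! ### The relations with respect to an identity -/

section Relations

variable {N : ℕ} {A : Type u} {B : Type v} [NonUnitalCStarAlgebra A] [NonUnitalCStarAlgebra B]

/-- The product `x_{t₁ g₁}^{c₁} ⋯ x_{t_k g_k}^{c_k} e`. -/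
def wordProd (e : A) {k : ℕ} (c : Fin k → Colour) (x : Matrix (Fin N) (Fin N) A)
    (t g : Fin k → Fin N) : A :=
  (List.ofFn fun i => (c i).pow (x (t i) (g i))).foldr (· * ·) e

/-- The relations of a partition, where `e` plays the role of the unit. -/
def Partition.RelWith (p : Partition) (e : A) (x : Matrix (Fin N) (Fin N) A) : Prop :=
  ∀ (γ : Fin p.k → Fin N) (γ' : Fin p.l → Fin N),
    ∑ t : Fin p.k → Fin N, p.delta t γ' • wordProd e p.upper x t γ =
      ∑ t' : Fin p.l → Fin N, p.delta γ t' • wordProd e p.lower x γ' t'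

lemma wordProd_succ (e : A) {k : ℕ} (c : Fin (k + 1) → Colour) (x : Matrix (Fin N) (Fin N) A)
    (t g : Fin (k + 1) → Fin N) : wordProd e c x t g =
      (c 0).pow (x (t 0) (g 0)) * wordProd e (fun i => c i.succ) x (fun i => t i.succ)
        fun i => g i.succ := by
  simp [wordProd, List.ofFn_succ]

lemma Colour.map_pow (f : A →⋆ₙₐ[ℂ] B) (a : A) (c : Colour) : f (c.pow a) = c.pow (f a) := by
  cases c
  · rfl
  · exact map_star f a

lemma map_wordProd (f : A →⋆ₙₐ[ℂ] B) (e : A) {k : ℕ} (c : Fin k → Colour)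
    (x : Matrix (Fin N) (Fin N) A) (t g : Fin k → Fin N) :
    f (wordProd e c x t g) = wordProd (f e) c (x.map f) t g := by
  induction k with
  | zero => rfl
  | succ k ih => rw [wordProd_succ, wordProd_succ, map_mul, ih, Colour.map_pow]; rfl

lemma map_relSum (f : A →⋆ₙₐ[ℂ] B) (e : A) (x : Matrix (Fin N) (Fin N) A) (p : Partition)
    (γ : Fin p.k → Fin N) (γ' : Fin p.l → Fin N) :
    (f (∑ t : Fin p.k → Fin N, p.delta t γ' • wordProd e p.upper x t γ) =
      ∑ t : Fin p.k → Fin N, p.delta t γ' • wordProd (f e) p.upper (x.map f) t γ) ∧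
    (f (∑ t' : Fin p.l → Fin N, p.delta γ t' • wordProd e p.lower x γ' t') =
      ∑ t' : Fin p.l → Fin N, p.delta γ t' • wordProd (f e) p.lower (x.map f) γ' t') := by
  simp only [map_sum, map_smul, map_wordProd, and_self]

lemma Partition.RelWith.map {p : Partition} {e : A} {x : Matrix (Fin N) (Fin N) A}
    (h : p.RelWith e x) (f : A →⋆ₙₐ[ℂ] B) : p.RelWith (f e) (x.map f) := fun γ γ' => by
  rw [← (map_relSum f e x p γ γ').1, ← (map_relSum f e x p γ γ').2, h]

lemma Partition.RelWith.of_map {p : Partition} {e : A} {x : Matrix (Fin N) (Fin N) A}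
    (f : A →⋆ₙₐ[ℂ] B) (hf : Function.Injective f) (h : p.RelWith (f e) (x.map f)) :
    p.RelWith e x := fun γ γ' => hf <| by
  rw [(map_relSum f e x p γ γ').1, (map_relSum f e x p γ γ').2, h]

lemma delta_lowerPair (c d : Colour) (γ : Fin 0 → Fin N) (i j : Fin N) :
    (lowerPair c d).delta γ ![i, j] = if i = j then 1 else 0 := by
  unfold Partition.delta
  congr 1
  have h01 : ∀ x y, (lowerPair c d).blocks x y := fun _ _ => trivial
  simp [lowerPair, eq_comm] at h01 ⊢
  simp [h01]

lemma delta_upperPair (c d : Colour) (γ : Fin 0 → Fin N) (i j : Fin N) :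
    (upperPair c d).delta ![i, j] γ = if i = j then 1 else 0 := by
  unfold Partition.delta
  congr 1
  have h01 : ∀ x y, (upperPair c d).blocks x y := fun _ _ => trivial
  simp [upperPair, eq_comm] at h01 ⊢
  simp [h01]

lemma sum_pair {M : Type*} [AddCommMonoid M] (F : (Fin 2 → Fin N) → M) :
    ∑ t, F t = ∑ i, ∑ j, F ![i, j] := by
  rw [← (finTwoArrowEquiv (Fin N)).symm.sum_comp, Fintype.sum_prod_type]
  rfl

/-- Colours white, black give `x x^* = 1`; black, white give `x^(*) xᵀ = 1`. -/
lemma Partition.RelWith.lowerPair {c d : Colour} {e : A} (he : IsIdentity e)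
    {x : Matrix (Fin N) (Fin N) A} (h : (lowerPair c d).RelWith e x) (i j : Fin N) :
    ∑ k, c.pow (x i k) * d.pow (x j k) = if i = j then e else 0 := by
  have h1 := h ![] ![i, j]
  change ∑ t : Fin 0 → Fin N, _ = ∑ t' : Fin 2 → Fin N, _ at h1
  rw [sum_pair] at h1
  simp only [delta_lowerPair] at h1
  rw [Fintype.sum_unique] at h1
  simpa [CQG.lowerPair, wordProd, List.ofFn_succ, (he _).2, eq_comm] using h1

/-- Colours black, white give `x^* x = 1`; white, black give `xᵀ x^(*) = 1`. -/
lemma Partition.RelWith.upperPair {c d : Colour} {e : A} (he : IsIdentity e)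
    {x : Matrix (Fin N) (Fin N) A} (h : (upperPair c d).RelWith e x) (i j : Fin N) :
    ∑ k, c.pow (x k i) * d.pow (x k j) = if i = j then e else 0 := by
  have h1 := h ![i, j] ![]
  change ∑ t : Fin 2 → Fin N, _ = ∑ t' : Fin 0 → Fin N, _ at h1
  rw [sum_pair] at h1
  simp only [delta_upperPair] at h1
  conv_rhs at h1 => rw [Fintype.sum_unique]
  simpa [CQG.upperPair, wordProd, List.ofFn_succ, (he _).2, eq_comm] using h1

end Relations

/-! ### Stability of the relations under `⦶` -/

section Products

variable {N : ℕ} {A B : Type u} [NonUnitalCStarAlgebra A] [NonUnitalCStarAlgebra B]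

lemma Colour.pow_wprod (c : Colour) (x : Matrix (Fin N) (Fin N) A) (y : Matrix (Fin N) (Fin N) B)
    (i j : Fin N) : c.pow (wprod x y i j) = ∑ k, tmin (c.pow (x i k)) (c.pow (y k j)) := by
  cases c
  · rfl
  · simp only [Colour.pow, wprod, star_sum, star_tmin]

/-- Each factor brings its own summation index, and elementary tensors multiply leg by leg; the
indices form the middle multi-index `s`. -/
lemma wordProd_wprod (e : A) (e' : B) {k : ℕ} (c : Fin k → Colour) (x : Matrix (Fin N) (Fin N) A)
    (y : Matrix (Fin N) (Fin N) B) (t g : Fin k → Fin N) :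
    wordProd (tmin e e') c (wprod x y) t g =
      ∑ s : Fin k → Fin N, tmin (wordProd e c x t s) (wordProd e' c y s g) := by
  induction k with
  | zero => rw [Fintype.sum_unique]; rfl
  | succ k ih =>
    rw [wordProd_succ, ih, Colour.pow_wprod,
      ← (Fin.consEquiv fun _ : Fin (k + 1) => Fin N).sum_comp, Fintype.sum_prod_type,
      Finset.sum_mul_sum]
    refine Finset.sum_congr rfl fun a _ => Finset.sum_congr rfl fun s _ => ?_
    rw [wordProd_succ, wordProd_succ e', tmin_mul]
    rfl

/-- The product of two models satisfies the relations. -/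
theorem Partition.RelWith.wprod {p : Partition} {e : A} {e' : B} {x : Matrix (Fin N) (Fin N) A}
    {y : Matrix (Fin N) (Fin N) B} (hx : p.RelWith e x) (hy : p.RelWith e' y) :
    p.RelWith (tmin e e') (wprod x y) := by
  intro γ γ'
  simp only [wordProd_wprod, Finset.smul_sum]
  calc ∑ t, ∑ s, p.delta t γ' • tmin (wordProd e p.upper x t s) (wordProd e' p.upper y s γ)
      = ∑ s, tmin (∑ t, p.delta t γ' • wordProd e p.upper x t s) (wordProd e' p.upper y s γ) := by
        rw [Finset.sum_comm]
        simp only [tmin_sum_left, tmin_smul_left]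
    -- The relation for `x` at `(s, γ')`; the new coefficient `δ_p(s, r)` moves to the second leg.
    _ = ∑ s, ∑ r, tmin (wordProd e p.lower x γ' r) (p.delta s r • wordProd e' p.upper y s γ) := by
        simp only [hx _ γ', tmin_sum_left, tmin_smul_left, tmin_smul_right]
    _ = ∑ r, tmin (wordProd e p.lower x γ' r) (∑ s, p.delta s r • wordProd e' p.upper y s γ) := by
        rw [Finset.sum_comm]
        simp only [tmin_sum_right]
    -- The relation for `y` at `(γ, r)`.
    _ = ∑ t', ∑ s, p.delta γ t' • tmin (wordProd e p.lower x γ' s) (wordProd e' p.lower y s t') := by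
        simp only [hy γ, tmin_sum_right, tmin_smul_right]
        rw [Finset.sum_comm]

end Products

/-! ### Arrows -/

section Arrows

variable {N : ℕ}

lemma Obj.hom_ext {X : Obj.{u} N} {B : Type v} [NonUnitalCStarAlgebra B] {f g : X.alg →⋆ₙₐ[ℂ] B}
    (h : ∀ i j, f (X.mat i j) = g (X.mat i j)) : f = g := by
  ext x
  refine eq_top_of_generates X.generated (NonUnitalStarAlgHom.equalizer f g)
    (isClosed_eq (continuous_starHom f) (continuous_starHom g)) ?_ x
  rintro _ ⟨⟨i, j⟩, rfl⟩
  exact h i j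

/-- Thinness of `C_N` makes naturality and uniqueness automatic for the limit. -/
instance (X Y : Obj.{u} N) : Subsingleton (X ⟶ Y) :=
  ⟨fun f g => Arrow.ext (Obj.hom_ext fun i j => (f.map_mat i j).trans (g.map_mat i j).symm)⟩

/-- A `*`-homomorphism that maps the matrix of `X` to the matrix `x`, as an arrow to the object
generated by `x`. -/
def Arrow.toGen {X : Obj.{u} N} (Y : MatPair.{v} N) (f : X.alg →⋆ₙₐ[ℂ] Y.alg)
    (hf : ∀ i j, f (X.mat i j) = Y.mat i j) : Arrow X Y.gen where
  hom := NonUnitalStarAlgHom.codRestrict f (cstarGen (entries Y.mat)) <|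
    map_mem_of_generates X.generated f _ (isClosed_cstarGen _) <| by
      rintro _ ⟨⟨i, j⟩, rfl⟩
      rw [hf]
      exact subset_cstarGen _ (mem_entries _ i j)
  map_mat i j := Subtype.ext (hf i j)

/-- The inclusion of the C*-algebra generated by the entries of a matrix. -/
def MatPair.incl (X : MatPair.{u} N) : X.gen.alg →⋆ₙₐ[ℂ] X.alg :=
  NonUnitalStarSubalgebraClass.subtype (cstarGen (entries X.mat))

lemma MatPair.incl_injective (X : MatPair.{u} N) : Function.Injective X.incl :=
  Subtype.val_injective

/-- The inclusion of the easy quantum group into the bounded families. -/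
def easyQG.incl (N : ℕ) (S : Set Partition) (hS : basicPairs ⊆ S) :
    (easyQG.{u} N S hS).alg →⋆ₙₐ[ℂ] (universalPair.{u} N S hS).alg :=
  (universalPair.{u} N S hS).incl.comp (shrinkHom (universalPair.{u} N S hS).gen.alg)

lemma easyQG.incl_injective (N : ℕ) (S : Set Partition) (hS : basicPairs ⊆ S) :
    Function.Injective (easyQG.incl.{u} N S hS) :=
  (universalPair.{u} N S hS).incl_injective.comp
    (equivShrink (universalPair.{u} N S hS).gen.alg).symm.injective

lemma easyQG.incl_mat (N : ℕ) (S : Set Partition) (hS : basicPairs ⊆ S) (i j : Fin N) :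
    easyQG.incl.{u} N S hS ((easyQG.{u} N S hS).mat i j) =
      (universalPair.{u} N S hS).mat i j := by
  change (((equivShrink (universalPair.{u} N S hS).gen.alg).symm
    (equivShrink _ ((universalPair.{u} N S hS).gen.mat i j))) : cstarGen _).1 = _
  rw [Equiv.symm_apply_apply]
  rfl

/-- The universal property of the easy quantum group. -/
theorem easyQG.exists_arrow {S : Set Partition} (hS : basicPairs ⊆ S) (X : MatPair.{u} N)
    {e : X.alg} (he : IsIdentity e) (h : ∀ p ∈ S, p.RelWith e X.mat) :
    Nonempty (easyQG.{u} N S hS ⟶ X.gen) := by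
  -- With `e` as the unit, `List.prod` is by definition the right fold ending in `e`, so `h` is
  -- literally the relation `Rel`.
  let m : RelModel.{u} N S :=
    { D := X.alg, str := unitalCStarAlgebra X.alg e he, x := X.mat, rel := h }
  let f : (universalPair.{u} N S hS).alg →⋆ₙₐ[ℂ] X.alg :=
    lpEval (D := fun m : RelModel.{u} N S => m.D) m
  refine ⟨Arrow.toGen X (f.comp (easyQG.incl N S hS)) fun i j => ?_⟩
  rw [NonUnitalStarAlgHom.comp_apply, easyQG.incl_mat]
  rfl

/-- The unit of the easy quantum group and its relations. -/
theorem easyQG.exists_identity [NeZero N] {S : Set Partition} (hS : basicPairs ⊆ S) :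
    ∃ e : (easyQG.{u} N S hS).alg, IsIdentity e ∧
      ∀ p ∈ S, p.RelWith e (easyQG.{u} N S hS).mat := by
  let ι := easyQG.incl.{u} N S hS
  have hι : Function.Injective ι := easyQG.incl_injective N S hS
  let U := (universalPair.{u} N S hS)
  let one : U.alg := (⟨fun m => 1, memℓp_infty ⟨1, by
    rintro _ ⟨m, rfl⟩
    exact norm_one_le⟩⟩ : lp (fun m : RelModel.{u} N S => m.D) ∞)
  have hone : IsIdentity one := fun a =>
    ⟨Subtype.ext (funext fun m => one_mul _), Subtype.ext (funext fun m => mul_one _)⟩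
  have hU : ∀ p ∈ S, p.RelWith one U.mat := by
    intro p hp γ γ'
    refine Subtype.ext (funext fun m => ?_)
    let f : U.alg →⋆ₙₐ[ℂ] m.D := lpEval (D := fun m : RelModel.{u} N S => m.D) m
    exact (map_relSum f one U.mat p γ γ').1.trans
      ((m.rel p hp γ γ').trans (map_relSum f one U.mat p γ γ').2.symm)
  have hmat : (easyQG.{u} N S hS).mat.map ι = U.mat := by
    ext i j
    exact easyQG.incl_mat N S hS i j
  -- The algebra is generated without a unit, but a diagonal entry of `u u^* = 1` exhibits the unit
  -- as a polynomial in the generators; the index `0` exists because `N ≥ 1`.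
  let e := ∑ k, (easyQG.{u} N S hS).mat 0 k * star ((easyQG.{u} N S hS).mat 0 k)
  have he : ι e = one := by
    have h := (hU _ (hS (by simp [basicPairs]))).lowerPair (c := .white) (d := .black) hone 0 0
    rw [if_pos rfl] at h
    rw [← h, map_sum]
    refine Finset.sum_congr rfl fun k _ => ?_
    rw [map_mul, map_star]
    simp only [ι, easyQG.incl_mat]
    rfl
  refine ⟨e, fun a => ⟨hι ?_, hι ?_⟩, fun p hp => ?_⟩
  · rw [map_mul, he, (hone _).1]
  · rw [map_mul, he, (hone _).2]
  · refine Partition.RelWith.of_map ι hι ?_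
    rw [he, hmat]
    exact hU p hp

end Arrows

/-! ### The powers of a model -/

variable {N : ℕ}

lemma map_wprod {A B : Type u} {D : Type v} [NonUnitalCStarAlgebra A] [NonUnitalCStarAlgebra B]
    [NonUnitalCStarAlgebra D] (f : MinTensor A B →⋆ₙₐ[ℂ] D) (x : Matrix (Fin N) (Fin N) A)
    (y : Matrix (Fin N) (Fin N) B) (i j : Fin N) :
    f (wprod x y i j) = ∑ k, f (tmin (x i k) (y k j)) := map_sum f _ _

lemma Rep.tensor_wprod {A B : Type u} [NonUnitalCStarAlgebra A] [NonUnitalCStarAlgebra B]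
    (r : Rep A) (s : Rep B) (x : Matrix (Fin N) (Fin N) A) (y : Matrix (Fin N) (Fin N) B)
    (i j : Fin N) :
    (r.tensor s).ξ (wprod x y i j) = ∑ k, opTensor (r.ξ (x i k)) (s.ξ (y k j)) := by
  rw [map_wprod]
  exact Finset.sum_congr rfl fun k _ => Rep.tensor_tmin _ _ _ _

/-- The representation `(r ∘ f) ⊗ (s ∘ g)` of `A ⊗ B` on the space of `r ⊗ s`. -/
def Rep.tensorComap {A B A' B' : Type u} [NonUnitalCStarAlgebra A]
    [NonUnitalCStarAlgebra B] [NonUnitalCStarAlgebra A'] [NonUnitalCStarAlgebra B']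
    (r : Rep A') (s : Rep B') (f : A →⋆ₙₐ[ℂ] A') (g : B →⋆ₙₐ[ℂ] B') :
    MinTensor A B →⋆ₙₐ[ℂ] ((r.tensor s).H →L[ℂ] (r.tensor s).H) :=
  ((r.comap f).tensor (s.comap g)).ξ

lemma Rep.tensorComap_wprod {A B A' B' : Type u} [NonUnitalCStarAlgebra A]
    [NonUnitalCStarAlgebra B] [NonUnitalCStarAlgebra A'] [NonUnitalCStarAlgebra B']
    (r : Rep A') (s : Rep B') (f : A →⋆ₙₐ[ℂ] A') (g : B →⋆ₙₐ[ℂ] B')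
    {x : Matrix (Fin N) (Fin N) A} {y : Matrix (Fin N) (Fin N) B}
    {x' : Matrix (Fin N) (Fin N) A'} {y' : Matrix (Fin N) (Fin N) B'}
    (hx : ∀ i j, f (x i j) = x' i j) (hy : ∀ i j, g (y i j) = y' i j) (i j : Fin N) :
    r.tensorComap s f g (wprod x y i j) = (r.tensor s).ξ (wprod x' y' i j) := by
  have hx' : x' = x.map f := by ext i j; exact (hx i j).symm
  have hy' : y' = y.map g := by ext i j; exact (hy i j).symm
  subst hx' hy'
  exact (Rep.tensor_wprod (r.comap f) (s.comap g) x y i j).trans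
    (Rep.tensor_wprod r s (x.map f) (y.map g) i j).symm

/-- The identification of `B₁^{⊗ (n + m + 2)}` with `B₁^{⊗ (n + 1)} ⊗ B₁^{⊗ (m + 1)}`. -/
theorem power.exists_split (B : Obj.{u} N) (n m : ℕ) :
    ∃ f : (power B (n + m + 1)).alg →⋆ₙₐ[ℂ] MinTensor (power B n).alg (power B m).alg,
      ∀ i j, f ((power B (n + m + 1)).mat i j) = wprod (power B n).mat (power B m).mat i j := by
  induction m with
  -- Index `n` stands for the power `n + 1`, so this case is the recursive definition of `power`.
  | zero => exact ⟨NonUnitalStarAlgHom.id ℂ _, fun i j => rfl⟩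
  | succ m ih =>
    obtain ⟨f, hf⟩ := ih
    obtain ⟨g, hg⟩ := MinTensor.exists_map f (NonUnitalStarAlgHom.id ℂ B.alg)
    obtain ⟨h, hh⟩ := MinTensor.exists_assoc (power B n).alg (power B m).alg B.alg
    refine ⟨h.comp g, fun i j => ?_⟩
    have hl : ∀ i j, h (g (wprod (power B (n + m + 1)).mat B.mat i j)) =
        ∑ k, ∑ l, tmin ((power B n).mat i l) (tmin ((power B m).mat l k) (B.mat k j)) := by
      intro i j
      rw [map_wprod, map_sum]
      refine Finset.sum_congr rfl fun k _ => ?_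
      rw [hg, hf, wprod, tmin_sum_left, map_sum]
      exact Finset.sum_congr rfl fun l _ => hh _ _ _
    refine (hl i j).trans ?_
    rw [Finset.sum_comm]
    exact Finset.sum_congr rfl fun l _ => (tmin_sum_right _ _ _).symm

/-! ### Comultiplication and the axioms of a compact matrix quantum group -/

/-- The comultiplication on a C*-algebra that is embedded into the product of all powers of a
model. -/
theorem power.exists_comul (B X : Obj.{u} N) (p : ∀ n, X.alg →⋆ₙₐ[ℂ] (power B n).alg)
    (hp : ∀ n i j, p n (X.mat i j) = (power B n).mat i j)
    (hinj : ∀ x, (∀ n, p n x = 0) → x = 0) :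
    ∃ Δ : X.alg →⋆ₙₐ[ℂ] MinTensor X.alg X.alg, ∀ i j, Δ (X.mat i j) = wprod X.mat X.mat i j := by
  choose f hf using power.exists_split B
  let R := Σ n, Rep (power B n).alg
  let r : R → Rep X.alg := fun a => a.2.comap (p a.1)
  have hr : ∀ x, (∀ a, (r a).ξ x = 0) → x = 0 := fun x hx =>
    hinj x fun n => Rep.ext fun s => hx ⟨n, s⟩
  let Φ : ∀ a : R × R, MinTensor X.alg X.alg →⋆ₙₐ[ℂ]
      ((a.1.2.tensor a.2.2).H →L[ℂ] (a.1.2.tensor a.2.2).H) :=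
    fun a => a.1.2.tensorComap a.2.2 (p a.1.1) (p a.2.1)
  -- The prescribed `(n, m)` component of `Δ`: project to the power `(n + 1) + (m + 1)`, whose index
  -- is `n + m + 1`, and split it.
  let Ψ : ∀ a : R × R, X.alg →⋆ₙₐ[ℂ]
      ((a.1.2.tensor a.2.2).H →L[ℂ] (a.1.2.tensor a.2.2).H) :=
    fun a => ((a.1.2.tensor a.2.2).ξ.comp (f a.1.1 a.2.1)).comp (p (a.1.1 + a.2.1 + 1))
  have hΦΨ : ∀ i j a, Φ a (wprod X.mat X.mat i j) = Ψ a (X.mat i j) := by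
    intro i j a
    have h1 : Ψ a (X.mat i j) = (a.1.2.tensor a.2.2).ξ
        (wprod (power B a.1.1).mat (power B a.2.1).mat i j) :=
      congrArg (a.1.2.tensor a.2.2).ξ ((congrArg _ (hp _ i j)).trans (hf _ _ i j))
    exact (Rep.tensorComap_wprod a.1.2 a.2.2 (p a.1.1) (p a.2.1) (hp _) (hp _) i j).trans h1.symm
  obtain ⟨Δ, hΔ⟩ := exists_lift Φ
    (fun x hx => MinTensor.eq_zero_of_separating r hr r hr x fun a b => hx (a, b)) Ψ X.generated (by
      rintro _ ⟨⟨i, j⟩, rfl⟩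
      exact ⟨_, hΦΨ i j⟩)
  exact ⟨Δ, fun i j => hΔ _ _ (hΦΨ i j)⟩

/-- The unit and the relations of an object below the easy quantum group. -/
theorem exists_identity_of_arrow [NeZero N] {S : Set Partition} {hS : basicPairs ⊆ S}
    {X : Obj.{u} N} (f : easyQG.{u} N S hS ⟶ X) :
    ∃ e : X.alg, IsIdentity e ∧ ∀ p ∈ S, p.RelWith e X.mat := by
  obtain ⟨e, he, hrel⟩ := easyQG.exists_identity.{u} (N := N) hS
  refine ⟨f.hom e, he.map_arrow f, fun p hp => ?_⟩
  have h : (easyQG.{u} N S hS).mat.map f.hom = X.mat := by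
    ext i j
    exact f.map_mat i j
  rw [← h]
  exact (hrel p hp).map f.hom

/-- An object below the easy quantum group is a compact matrix quantum group as soon as it has a
comultiplication. -/
theorem isCMQG_of_arrow [NeZero N] {S : Set Partition} {hS : basicPairs ⊆ S}
    {X : Obj.{u} N} (f : easyQG.{u} N S hS ⟶ X) (Δ : X.alg →⋆ₙₐ[ℂ] MinTensor X.alg X.alg)
    (hΔ : ∀ i j, Δ (X.mat i j) = wprod X.mat X.mat i j) : IsCMQG X := by
  obtain ⟨e, he, hrel⟩ := exists_identity_of_arrow f
  have hwb := hrel _ (hS (show lowerPair .white .black ∈ basicPairs by simp [basicPairs]))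
  have hbw := hrel _ (hS (show lowerPair .black .white ∈ basicPairs by simp [basicPairs]))
  have hwb' := hrel _ (hS (show upperPair .white .black ∈ basicPairs by simp [basicPairs]))
  have hbw' := hrel _ (hS (show upperPair .black .white ∈ basicPairs by simp [basicPairs]))
  refine ⟨e, he, ?_, ?_, ⟨X.mat.transpose, ?_, ?_⟩, Δ, ?_, hΔ⟩
  · ext i j
    rw [Matrix.mul_apply, Matrix.diagonal_apply]
    exact hwb.lowerPair he i j
  · ext i j
    rw [Matrix.mul_apply, Matrix.diagonal_apply]
    exact hbw'.upperPair he i j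
  · ext i j
    rw [Matrix.mul_apply, Matrix.diagonal_apply]
    exact hbw.lowerPair he i j
  · ext i j
    rw [Matrix.mul_apply, Matrix.diagonal_apply]
    exact hwb'.upperPair he i j
  · have h1 := hwb.lowerPair he 0 0
    -- `Δ` is unital since `e = ∑ u_0k u_0k^*`, and the same identity holds for `u ⦶ u = Δ(u)` with
    -- unit `e ⊗ e`.
    have h2 := (hwb.wprod hwb).lowerPair (he.tmin he) 0 0
    rw [if_pos rfl] at h1 h2
    have h3 : Δ e = tmin e e := by
      rw [← h1, map_sum, h1, ← h2]
      refine Finset.sum_congr rfl fun k _ => ?_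
      rw [map_mul, Colour.map_pow, Colour.map_pow, hΔ]
    rw [h3]
    exact he.tmin he

/-- The matrices of all powers of a model satisfy its relations. -/
theorem power.exists_identity {S : Set Partition} (B : Obj.{u} N) {e : B.alg} (he : IsIdentity e)
    (hB : ∀ p ∈ S, p.RelWith e B.mat) (n : ℕ) :
    ∃ e : (power B n).alg, IsIdentity e ∧ ∀ p ∈ S, p.RelWith e (power B n).mat := by
  induction n with
  | zero => exact ⟨e, he, hB⟩
  | succ n ih =>
    obtain ⟨e', he', h⟩ := ih
    exact ⟨tmin e' e, he'.tmin he, fun p hp => (h p hp).wprod (hB p hp)⟩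

/-! ### Limits of inverse sequences -/

section Limit

variable {X : ℕ → Obj.{u} N} (π : ∀ n, X (n + 1) ⟶ X n) {Y : Obj.{u} N} (f : ∀ n, Y ⟶ X n)

/-- The matrix over the product of the `X n` whose components are the matrices of the `X n`. The
object `Y` above all `X n` guarantees that its entries are bounded. -/
def productPair : MatPair.{u} N where
  alg := lp (fun n => (X n).alg) ∞
  mat := fun i j => lpHom (fun n => (f n).hom) (Y.mat i j)

lemma productPair_mat (i j : Fin N) (n : ℕ) :
    lpEval (D := fun n => (X n).alg) n ((productPair f).mat i j) = (X n).mat i j :=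
  (f n).map_mat i j

/-- The arrow from the generated subalgebra of the product to a component. -/
def productPair.proj (n : ℕ) : (productPair f).gen ⟶ X n where
  hom := NonUnitalStarAlgHom.comp (lpEval (D := fun n => (X n).alg) n) (productPair f).incl
  map_mat i j := productPair_mat f i j n

lemma productPair.eq_zero {x : (productPair f).gen.alg}
    (hx : ∀ n, (productPair.proj f n).hom x = 0) : x = 0 :=
  (productPair f).incl_injective <| Subtype.ext <| funext hx

/-- An object above all `X n` is above the generated subalgebra of the product. -/
def productPair.lift {Z : Obj.{u} N} (g : ∀ n, Z ⟶ X n) : Z ⟶ (productPair f).gen :=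
  Arrow.toGen (productPair f) (lpHom fun n => (g n).hom) fun i j =>
    Subtype.ext <| funext fun n => ((g n).map_mat i j).trans (productPair_mat f i j n).symm

/-- The cone over an inverse sequence given by the generated subalgebra of the product. -/
def sequenceCone : Limits.Cone (Functor.ofOpSequence π) where
  pt := (productPair f).gen
  π := { app := fun n => productPair.proj f n.unop
         naturality := fun _ _ _ => Subsingleton.elim (α := (productPair f).gen ⟶ _) _ _ }

/-- The generated subalgebra of the product is the limit of an inverse sequence. -/
def sequenceConeIsLimit : Limits.IsLimit (sequenceCone π f) where
  lift s := productPair.lift f fun n => s.π.app (Opposite.op n)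
  fac s n := Subsingleton.elim (α := s.pt ⟶ X n.unop) _ _
  uniq s _ _ := Subsingleton.elim (α := s.pt ⟶ (productPair f).gen) _ _

end Limit

end

end CQG

/-! ### The proposition -/

open CQG in
theorem mainTheorem4 (N : ℕ) [NeZero N] (S : Set CQG.Partition) (hS : CQG.basicPairs ⊆ S)
    (B : CQG.Obj.{u} N) (φ₁ : CQG.easyQG.{u} N S hS ⟶ B) (ν : CQG.Arrow B (CQG.oneObj N)) :
    ∃ π : ∀ n, CQG.model B (n + 1) ⟶ CQG.model B n,
      (∀ n, ∃ idν : CQG.MinTensor (CQG.power B n).alg B.alg →⋆ₙₐ[ℂ] (CQG.power B n).alg,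
        (∀ a b, idν (CQG.tmin a b) = ν.toComplex b • a) ∧
        ∀ x, CQG.model.incl B n ((π n).hom x) = idν (CQG.model.incl B (n + 1) x)) ∧
      (∀ n, Nonempty (CQG.easyQG.{u} N S hS ⟶ CQG.model B n)) ∧
      ∃ L : Limits.Cone (Functor.ofOpSequence π),
        Nonempty (Limits.IsLimit L) ∧ CQG.IsCMQG L.pt ∧
        Nonempty (CQG.easyQG.{u} N S hS ⟶ L.pt) := by
  have hid : ∀ n, ∃ idν : MinTensor (power B n).alg B.alg →⋆ₙₐ[ℂ] (power B n).alg,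
      ∀ a b, idν (tmin a b) = ν.toComplex b • a :=
    fun n => MinTensor.exists_id_tensor ν.toComplex
  choose idν hidν using hid
  have hν : ∀ i j, ν.toComplex (B.mat i j) = (1 : Matrix (Fin N) (Fin N) ℂ) i j := ν.map_mat
  -- Applying `ν` to the second leg leaves `∑ k, δ_kj • (M_n)_ik`.
  have hmat : ∀ n i j, idν n (wprod (power B n).mat B.mat i j) = (power B n).mat i j := by
    intro n i j
    rw [map_wprod]
    simp [hidν, hν, Matrix.one_apply]
  let π : ∀ n, model B (n + 1) ⟶ model B n := fun n =>
    Arrow.toGen (X := model B (n + 1)) (power B n) ((idν n).comp (model.incl B (n + 1))) (hmat n)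
  obtain ⟨e, he, hB⟩ := exists_identity_of_arrow φ₁
  have harrow : ∀ n, Nonempty (easyQG.{u} N S hS ⟶ model B n) := fun n => by
    obtain ⟨e', he', h⟩ := power.exists_identity B he hB n
    exact easyQG.exists_arrow hS (power B n) he' h
  let f : ∀ n, easyQG.{u} N S hS ⟶ model B n := fun n => (harrow n).some
  refine ⟨π, fun n => ⟨idν n, hidν n, fun x => rfl⟩, harrow,
    sequenceCone π f, ⟨sequenceConeIsLimit π f⟩, ?_, ⟨productPair.lift f f⟩⟩
  -- The maps from the limit to the full powers of `B₁` are jointly injective: each model embeds in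
  -- its power, and the limit embeds in the product of the models.
  obtain ⟨Δ, hΔ⟩ := power.exists_comul B (productPair f).gen
    (fun n => (model.incl B n).comp (productPair.proj f n).hom)
    (fun n i j => congrArg (model.incl B n) ((productPair.proj f n).map_mat i j))
    (fun x hx => productPair.eq_zero f fun n =>
      (power B n).incl_injective ((hx n).trans (map_zero _).symm))
  exact isCMQG_of_arrow (productPair.lift f f) Δ hΔ
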